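/- \textbf{Structure Theorem for finite-dimensional Hopf algebras.} Let $k$ be a field. For a positive integer $n$ let $\mathcal M_n(k)$ be the algebra of $n\times n$ matrices over $k$. An \emph{invertible pentagon solution} is an invertible element $R\in \mathcal M_n(k)\otimes \mathcal M_n(k)$ with $R^{12}R^{13}R^{23}=R^{23}R^{12}$ in $\mathcal M_n(k)^{\otimes 3}$. For $R=\sum R^1\otimes R^2$ let $$P(n,R)=\Big\{\sum f(R^2)\,R^1 \;\Big|\; f\in \mathcal M_n(k)^*\Big\}$$ be the space of left coefficients of $R$. It is a unital subalgebra of $\mathcal M_n(k)$, and it carries the comultiplication $\Delta(x)=R^{-1}(I_n\otimes x)R\in P(n,R)\otimes P(n,R)$ and the counit $\varepsilon$ determined by $\varepsilon\big(\sum f(R^2)R^1\big)=f(I_n)$ for all $f\in\mathcal M_n(k)^*$. Let $l(R)$ be the least $m$ such that $R$ is a sum of $m$ elementary tensors, and let $$\mathcal M_n(k)^{R,r}=\{a\in \mathcal M_n(k)\mid (I_n\otimes a)R=I_n\otimes a\}.$$ Let $L$ be a $k$-algebra (associative, with unit) with linear maps $\Delta_L:L\to L\otimes L$ and $\varepsilon_L:L\to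 k$. Then $L$ is a finite-dimensional Hopf algebra with comultiplication $\Delta_L$ and counit $\varepsilon_L$ if and only if there exist a positive integer $n$ and an invertible pentagon solution $R\in \mathcal M_n(k)\otimes \mathcal M_n(k)$ such that $L\cong P(n,R)$ (an algebra isomorphism compatible with the comultiplications and counits). In particular every $P(n,R)$ is a finite-dimensional Hopf algebra. Furthermore, for every positive integer $n$ and every invertible pentagon solution $R\in \mathcal M_n(k)\otimes \mathcal M_n(k)$ with $L\cong P(n,R)$, $$\dim(L)=\frac{n^2}{\dim(\mathcal M_n(k)^{R,r})}=l(R).$$ -/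

import Mathlib

open scoped TensorProduct

namespace Pentagon

/-! ### The pentagon equation -/

/-- `T ↦ T¹²`, the algebra map `a ⊗ b ↦ a ⊗ b ⊗ 1`. -/
noncomputable def leg12 (k A : Type*) [Field k] [Ring A] [Algebra k A] :
    A ⊗[k] A →ₐ[k] A ⊗[k] (A ⊗[k] A) :=
  Algebra.TensorProduct.map (AlgHom.id k A) Algebra.TensorProduct.includeLeft

/-- `T ↦ T¹³`, the algebra map `a ⊗ b ↦ a ⊗ 1 ⊗ b`. -/
noncomputable def leg13 (k A : Type*) [Field k] [Ring A] [Algebra k A] :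
    A ⊗[k] A →ₐ[k] A ⊗[k] (A ⊗[k] A) :=
  Algebra.TensorProduct.map (AlgHom.id k A) Algebra.TensorProduct.includeRight

/-- `T ↦ T²³`, the algebra map `a ⊗ b ↦ 1 ⊗ a ⊗ b`. -/
noncomputable def leg23 (k A : Type*) [Field k] [Ring A] [Algebra k A] :
    A ⊗[k] A →ₐ[k] A ⊗[k] (A ⊗[k] A) :=
  Algebra.TensorProduct.includeRight

/-- An invertible element `R` of `A ⊗ A` with `R¹² R¹³ R²³ = R²³ R¹²`. -/
structure PentagonSolution (k A : Type*) [Field k] [Ring A] [Algebra k A] where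
  /-- the invertible element `R`, together with its inverse -/
  unit : (A ⊗[k] A)ˣ
  pentagon : leg12 k A unit * leg13 k A unit * leg23 k A unit =
    leg23 k A unit * leg12 k A unit

section

variable {k A : Type*} [Field k] [Ring A] [Algebra k A]

/-! ### Coefficient spaces, length and coinvariants -/

/-- For `T = ∑ T¹ ⊗ T²`, the linear map `f ↦ ∑ f(T²) T¹`. -/
noncomputable def leftSlice (T : A ⊗[k] A) : Module.Dual k A →ₗ[k] A where
  toFun f := TensorProduct.rid k A (f.lTensor A T)
  map_add' f g := by simp [LinearMap.lTensor_add]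
  map_smul' c f := by simp [LinearMap.lTensor_smul]

/-- For `T = ∑ T¹ ⊗ T²`, the linear map `f ↦ ∑ f(T¹) T²`. -/
noncomputable def rightSlice (T : A ⊗[k] A) : Module.Dual k A →ₗ[k] A where
  toFun f := TensorProduct.lid k A (f.rTensor A T)
  map_add' f g := by simp [LinearMap.rTensor_add]
  map_smul' c f := by simp [LinearMap.rTensor_smul]

/-- The space of left coefficients of `T`. -/
noncomputable def leftCoeff (T : A ⊗[k] A) : Submodule k A := LinearMap.range (leftSlice T)

/-- The space of right coefficients of `T`. -/
noncomputable def rightCoeff (T : A ⊗[k] A) : Submodule k A := LinearMap.range (rightSlice T)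

/-- The length `l(T)`: the least `m` such that `T` is a sum of `m` elementary tensors. -/
noncomputable def tensorLength (T : A ⊗[k] A) : ℕ :=
  sInf {m : ℕ | ∃ a b : Fin m → A, T = ∑ i, a i ⊗ₜ[k] b i}

/-- The right coinvariants `{a ∈ A | (1 ⊗ a) T = 1 ⊗ a}`. -/
noncomputable def rightCoinvariants (T : A ⊗[k] A) : Submodule k A where
  carrier := {a | ((1 : A) ⊗ₜ[k] a) * T = (1 : A) ⊗ₜ[k] a}
  zero_mem' := by simp
  add_mem' {a b} ha hb := by
    simp only [Set.mem_ofPred_eq] at ha hb ⊢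
    rw [TensorProduct.tmul_add, add_mul, ha, hb]
  smul_mem' c a ha := by
    simp only [Set.mem_ofPred_eq] at ha ⊢
    rw [TensorProduct.tmul_smul, smul_mul_assoc, ha]

/-! ### Facts needed for the construction of `P(A, R)` -/

theorem leftSlice_sum [Module.Finite k A] (T : A ⊗[k] A) :
    T = ∑ s, leftSlice T ((Module.finBasis k A).coord s) ⊗ₜ[k] Module.finBasis k A s := by
  induction T with
  | zero => simp [leftSlice]
  | add x y hx hy =>
    conv_lhs => rw [hx, hy]
    simp [leftSlice, TensorProduct.add_tmul, Finset.sum_add_distrib]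
  | tmul a b =>
    conv_lhs => rw [← (Module.finBasis k A).sum_repr b, TensorProduct.tmul_sum]
    simp [leftSlice, TensorProduct.smul_tmul]

theorem rightSlice_sum [Module.Finite k A] (T : A ⊗[k] A) :
    T = ∑ s, Module.finBasis k A s ⊗ₜ[k] rightSlice T ((Module.finBasis k A).coord s) := by
  induction T with
  | zero => simp [rightSlice]
  | add x y hx hy =>
    conv_lhs => rw [hx, hy]
    simp [rightSlice, TensorProduct.tmul_add, Finset.sum_add_distrib]
  | tmul a b =>
    conv_lhs => rw [← (Module.finBasis k A).sum_repr a, TensorProduct.sum_tmul]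
    simp only [rightSlice, TensorProduct.smul_tmul]
    simp

theorem dual_leftSlice (T : A ⊗[k] A) (f g : Module.Dual k A) :
    g (leftSlice T f) = f (rightSlice T g) := by
  induction T with
  | zero => simp [leftSlice, rightSlice]
  | add x y hx hy => simp_all [leftSlice, rightSlice]
  | tmul a b => simp [leftSlice, rightSlice, mul_comm]

/-- `f ⊗ g`, as a functional on `A ⊗ A`. -/
noncomputable abbrev pair (f g : Module.Dual k A) : A ⊗[k] A →ₗ[k] k :=
  LinearMap.mul' k k ∘ₗ TensorProduct.map f g

/-- `f ⊗ g ⊗ id`. -/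
noncomputable abbrev slice12 (f g : Module.Dual k A) : A ⊗[k] (A ⊗[k] A) →ₗ[k] A :=
  TensorProduct.lid k A ∘ₗ (pair f g).rTensor A ∘ₗ (TensorProduct.assoc k A A A).symm.toLinearMap

/-- `id ⊗ id ⊗ f`. -/
noncomputable abbrev slice3 (f : Module.Dual k A) : A ⊗[k] (A ⊗[k] A) →ₗ[k] A ⊗[k] A :=
  (TensorProduct.rid k A ∘ₗ f.lTensor A).lTensor A

theorem leftSlice_mul (T T' : A ⊗[k] A) (f g : Module.Dual k A) :
    TensorProduct.rid k A ((pair f g).lTensor A (leg12 k A T * leg13 k A T')) =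
      leftSlice T f * leftSlice T' g := by
  induction T with
  | zero => simp [leftSlice]
  | add x y hx hy => simp_all [leftSlice, add_mul]
  | tmul a b =>
    induction T' with
    | zero => simp [leftSlice]
    | add x y hx hy => simp_all [leftSlice, mul_add]
    | tmul c d => simp [leftSlice, leg12, leg13, pair, smul_smul, mul_comm (f b)]

theorem leftSlice_conj (S U T : A ⊗[k] A) (φ : A ⊗[k] A →ₗ[k] k) :
    TensorProduct.rid k A (φ.lTensor A (leg23 k A S * leg12 k A T * leg23 k A U)) =
      leftSlice T (φ ∘ₗ LinearMap.mulLeft k S ∘ₗ LinearMap.mulRight k U ∘ₗ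
        (TensorProduct.mk k A A).flip 1) := by
  induction T with
  | zero => simp [leftSlice]
  | add x y hx hy => simp_all [leftSlice, mul_add, add_mul]
  | tmul a b => simp [leftSlice, leg12, leg23, mul_assoc]

theorem rightSlice_mul (T T' : A ⊗[k] A) (f g : Module.Dual k A) :
    slice12 f g (leg13 k A T * leg23 k A T') = rightSlice T f * rightSlice T' g := by
  induction T with
  | zero => simp [rightSlice]
  | add x y hx hy => simp_all [rightSlice, add_mul]
  | tmul a b =>
    induction T' with
    | zero => simp [rightSlice]
    | add x y hx hy => simp_all [rightSlice, mul_add]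
    | tmul c d => simp [rightSlice, leg23, leg13, pair, smul_smul, mul_comm (f a)]

theorem rightSlice_conj (S U T : A ⊗[k] A) (f g : Module.Dual k A) :
    slice12 f g (leg12 k A S * (leg23 k A T * leg12 k A U)) =
      rightSlice T (pair f g ∘ₗ LinearMap.mulLeft k S ∘ₗ LinearMap.mulRight k U ∘ₗ
        TensorProduct.mk k A A 1) := by
  induction T with
  | zero => simp [rightSlice]
  | add x y hx hy => simp_all [rightSlice, mul_add, add_mul]
  | tmul a b =>
    induction S with
    | zero => simp [rightSlice]
    | add x y hx hy => simp_all [rightSlice, add_mul, add_smul]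
    | tmul c d =>
      induction U with
      | zero => simp [rightSlice]
      | add x y hx hy => simp_all [rightSlice, mul_add, add_smul]
      | tmul p q => simp [rightSlice, leg12, leg23, pair]

theorem slice3_conj (S U T : A ⊗[k] A) (f : Module.Dual k A) :
    slice3 f (leg12 k A S * (leg23 k A T * leg12 k A U)) =
      S * ((1 : A) ⊗ₜ[k] leftSlice T f) * U := by
  induction T with
  | zero => simp [leftSlice]
  | add x y hx hy => simp_all [leftSlice, mul_add, add_mul, TensorProduct.tmul_add]
  | tmul a b =>
    induction S with
    | zero => simp [leftSlice]
    | add x y hx hy => simp_all [leftSlice, add_mul]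
    | tmul c d =>
      induction U with
      | zero => simp [leftSlice]
      | add x y hx hy => simp_all [leftSlice, mul_add]
      | tmul p q => simp [leftSlice, leg12, leg23, mul_assoc]

theorem one_mem_of_unit_mem {B : Type*} [Ring B] [Algebra k B] [Module.Finite k B]
    (M : Submodule k B) (u : Bˣ) (hu : (u : B) ∈ M) (hmul : ∀ x ∈ M, (u : B) * x ∈ M) :
    (1 : B) ∈ M := by
  have hinj : Function.Injective ((LinearMap.mulLeft k (u : B)).restrict hmul) := by
    intro x y h
    have h1 : (u : B) * x = u * y := congrArg Subtype.val h
    exact Subtype.ext ((Units.mul_right_inj u).mp h1)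
  obtain ⟨x, hx⟩ := LinearMap.injective_iff_surjective.mp hinj ⟨u, hu⟩
  have h1 : (u : B) * x = u * 1 := (congrArg Subtype.val hx).trans (mul_one _).symm
  exact (Units.mul_right_inj u).mp h1 ▸ x.2

namespace PentagonSolution

theorem leg13_mul_leg23 (R : PentagonSolution k A) :
    leg13 k A R.unit * leg23 k A R.unit =
      leg12 k A ↑R.unit⁻¹ * (leg23 k A R.unit * leg12 k A R.unit) := by
  rw [← R.pentagon, mul_assoc, ← mul_assoc (leg12 k A _), ← map_mul, Units.inv_mul, map_one,
    one_mul]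

theorem leg12_mul_leg13 (R : PentagonSolution k A) :
    leg12 k A R.unit * leg13 k A R.unit =
      leg23 k A R.unit * leg12 k A R.unit * leg23 k A ↑R.unit⁻¹ := by
  rw [← R.pentagon, mul_assoc _ (leg23 k A _) (leg23 k A _), ← map_mul, Units.mul_inv, map_one,
    mul_one]

theorem mul_mem_leftCoeff (R : PentagonSolution k A) {x y : A}
    (hx : x ∈ leftCoeff (R.unit : A ⊗[k] A)) (hy : y ∈ leftCoeff (R.unit : A ⊗[k] A)) :
    x * y ∈ leftCoeff (R.unit : A ⊗[k] A) := by
  obtain ⟨f, rfl⟩ := hx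
  obtain ⟨g, rfl⟩ := hy
  rw [← leftSlice_mul, R.leg12_mul_leg13, leftSlice_conj]
  exact LinearMap.mem_range_self _ _

theorem mul_mem_rightCoeff (R : PentagonSolution k A) {x y : A}
    (hx : x ∈ rightCoeff (R.unit : A ⊗[k] A)) (hy : y ∈ rightCoeff (R.unit : A ⊗[k] A)) :
    x * y ∈ rightCoeff (R.unit : A ⊗[k] A) := by
  obtain ⟨f, rfl⟩ := hx
  obtain ⟨g, rfl⟩ := hy
  rw [← rightSlice_mul, R.leg13_mul_leg23, rightSlice_conj]
  exact LinearMap.mem_range_self _ _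

theorem one_mem_leftCoeff [Module.Finite k A] (R : PentagonSolution k A) :
    (1 : A) ∈ leftCoeff (R.unit : A ⊗[k] A) := by
  set P := leftCoeff (R.unit : A ⊗[k] A) with hP
  rcases subsingleton_or_nontrivial A with h | h
  · rw [Subsingleton.elim (1 : A) 0]
    exact zero_mem _
  have h1 : (1 : A ⊗[k] A) ∈ LinearMap.range (P.subtype.rTensor A) := by
    have hR : (R.unit : A ⊗[k] A) ∈ LinearMap.range (P.subtype.rTensor A) := by
      rw [leftSlice_sum (R.unit : A ⊗[k] A)]
      exact Submodule.sum_mem _ fun s _ ↦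
        ⟨(⟨leftSlice _ ((Module.finBasis k A).coord s), LinearMap.mem_range_self _ _⟩ : P)
          ⊗ₜ[k] Module.finBasis k A s, by simp⟩
    refine one_mem_of_unit_mem _ R.unit hR ?_
    rintro _ ⟨y, rfl⟩
    obtain ⟨z, hz⟩ := hR
    rw [← hz]
    clear hz
    induction z with
    | zero => simp
    | add x y hx hy => rw [map_add, add_mul]; exact add_mem hx hy
    | tmul a b =>
      induction y with
      | zero => simp
      | add x y hx hy => rw [map_add, mul_add]; exact add_mem hx hy
      | tmul c d =>
        exact ⟨(⟨a * c, R.mul_mem_leftCoeff a.2 c.2⟩ : P) ⊗ₜ (b * d), by simp⟩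
  obtain ⟨g, hg⟩ := Module.Projective.exists_dual_eq_one k (one_ne_zero (α := A))
  obtain ⟨w, hw⟩ := h1
  have key : leftSlice (P.subtype.rTensor A w) g ∈ P := by
    clear hw
    induction w with
    | zero => simp [leftSlice]
    | add x y hx hy => simpa [leftSlice] using add_mem hx hy
    | tmul a b => simpa [leftSlice] using P.smul_mem (g b) a.2
  rw [hw] at key
  simpa [leftSlice, Algebra.TensorProduct.one_def, hg] using key

theorem one_mem_rightCoeff [Module.Finite k A] (R : PentagonSolution k A) :
    (1 : A) ∈ rightCoeff (R.unit : A ⊗[k] A) := by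
  set P := rightCoeff (R.unit : A ⊗[k] A) with hP
  rcases subsingleton_or_nontrivial A with h | h
  · rw [Subsingleton.elim (1 : A) 0]
    exact zero_mem _
  have h1 : (1 : A ⊗[k] A) ∈ LinearMap.range (P.subtype.lTensor A) := by
    have hR : (R.unit : A ⊗[k] A) ∈ LinearMap.range (P.subtype.lTensor A) := by
      rw [rightSlice_sum (R.unit : A ⊗[k] A)]
      exact Submodule.sum_mem _ fun s _ ↦
        ⟨Module.finBasis k A s ⊗ₜ[k]
          (⟨rightSlice _ ((Module.finBasis k A).coord s), LinearMap.mem_range_self _ _⟩ : P),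
          by simp⟩
    refine one_mem_of_unit_mem _ R.unit hR ?_
    rintro _ ⟨y, rfl⟩
    obtain ⟨z, hz⟩ := hR
    rw [← hz]
    clear hz
    induction z with
    | zero => simp
    | add x y hx hy => rw [map_add, add_mul]; exact add_mem hx hy
    | tmul a b =>
      induction y with
      | zero => simp
      | add x y hx hy => rw [map_add, mul_add]; exact add_mem hx hy
      | tmul c d =>
        exact ⟨(a * c) ⊗ₜ (⟨b * d, R.mul_mem_rightCoeff b.2 d.2⟩ : P), by simp⟩
  obtain ⟨g, hg⟩ := Module.Projective.exists_dual_eq_one k (one_ne_zero (α := A))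
  obtain ⟨w, hw⟩ := h1
  have key : rightSlice (P.subtype.lTensor A w) g ∈ P := by
    clear hw
    induction w with
    | zero => simp [rightSlice]
    | add x y hx hy => simpa [rightSlice] using add_mem hx hy
    | tmul a b => simpa [rightSlice] using P.smul_mem (g a) b.2
  rw [hw] at key
  simpa [rightSlice, Algebra.TensorProduct.one_def, hg] using key

/-! ### The algebra `P(A, R)` with its comultiplication and counit -/

/-- `P(A, R)`: the subalgebra of `A` whose underlying space is the space of left coefficients
of `R`. -/
noncomputable def P [Module.Finite k A] (R : PentagonSolution k A) : Subalgebra k A :=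
  (leftCoeff (R.unit : A ⊗[k] A)).toSubalgebra R.one_mem_leftCoeff
    fun _ _ hx hy ↦ R.mul_mem_leftCoeff hx hy

/-- The linear map `A → A ⊗ A`, `x ↦ R⁻¹ (1 ⊗ x) R`. -/
noncomputable def conj (R : PentagonSolution k A) : A →ₗ[k] A ⊗[k] A :=
  LinearMap.mulLeft k (↑R.unit⁻¹) ∘ₗ LinearMap.mulRight k (R.unit : A ⊗[k] A) ∘ₗ
    TensorProduct.mk k A A 1

theorem conj_apply (R : PentagonSolution k A) (x : A) :
    R.conj x = ↑R.unit⁻¹ * ((1 : A) ⊗ₜ[k] x) * (R.unit : A ⊗[k] A) := by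
  simp [conj, mul_assoc]

variable [Module.Finite k A] (R : PentagonSolution k A)

/-- The inclusion of `P(A, R) ⊗ P(A, R)` in `A ⊗ A`. -/
noncomputable def incl : R.P ⊗[k] R.P →ₗ[k] A ⊗[k] A :=
  TensorProduct.map R.P.val.toLinearMap R.P.val.toLinearMap

theorem incl_injective : Function.Injective R.incl :=
  TensorProduct.map_injective_of_flat_flat _ _ Subtype.val_injective Subtype.val_injective

theorem conj_mem (x : R.P) : R.conj x ∈ LinearMap.range R.incl := by
  obtain ⟨_, ⟨f, rfl⟩⟩ := x
  have h : R.conj (leftSlice (R.unit : A ⊗[k] A) f) =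
      slice3 f (leg13 k A R.unit * leg23 k A R.unit) := by
    rw [conj_apply, R.leg13_mul_leg23, slice3_conj]
  have hs : ∀ s, leftSlice (R.unit : A ⊗[k] A) s ∈ R.P := fun s ↦ LinearMap.mem_range_self _ s
  change R.conj (leftSlice (R.unit : A ⊗[k] A) f) ∈ _
  rw [h, leftSlice_sum (R.unit : A ⊗[k] A), map_sum, map_sum, Finset.sum_mul_sum, map_sum]
  refine Submodule.sum_mem _ fun s _ ↦ ?_
  rw [map_sum]
  refine Submodule.sum_mem _ fun t _ ↦ ?_
  exact ⟨(f (Module.finBasis k A s * Module.finBasis k A t)) •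
    ((⟨_, hs ((Module.finBasis k A).coord s)⟩ : R.P) ⊗ₜ[k]
      (⟨_, hs ((Module.finBasis k A).coord t)⟩ : R.P)), by simp [incl, leg13, leg23]⟩

/-- The comultiplication of `P(A, R)`: the unique map to `P(A, R) ⊗ P(A, R)` which becomes
`x ↦ R⁻¹ (1 ⊗ x) R` in `A ⊗ A`. -/
noncomputable def comul : R.P →ₗ[k] R.P ⊗[k] R.P :=
  (LinearEquiv.ofInjective R.incl R.incl_injective).symm.toLinearMap ∘ₗ
    (R.conj ∘ₗ R.P.val.toLinearMap).codRestrict (LinearMap.range R.incl) R.conj_mem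

theorem incl_comul (x : R.P) :
    R.incl (R.comul x) = ↑R.unit⁻¹ * ((1 : A) ⊗ₜ[k] (x : A)) * (R.unit : A ⊗[k] A) := by
  have h := congrArg Subtype.val ((LinearEquiv.ofInjective R.incl R.incl_injective).apply_symm_apply
    ((R.conj ∘ₗ R.P.val.toLinearMap).codRestrict (LinearMap.range R.incl) R.conj_mem x))
  rw [← conj_apply]
  exact h

/-- `f ↦ ∑ f(R²) R¹`, as a map onto `P(A, R)`. -/
noncomputable def slice : Module.Dual k A →ₗ[k] R.P :=
  (leftSlice (R.unit : A ⊗[k] A)).codRestrict (Subalgebra.toSubmodule R.P)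
    fun f ↦ LinearMap.mem_range_self _ f

theorem slice_surjective : Function.Surjective R.slice := by
  rintro ⟨_, ⟨f, rfl⟩⟩
  exact ⟨f, rfl⟩

theorem ker_slice_le : LinearMap.ker R.slice ≤ LinearMap.ker (Module.Dual.eval k A 1) := by
  intro f hf
  have hf' : leftSlice (R.unit : A ⊗[k] A) f = 0 := congrArg Subtype.val hf
  obtain ⟨g, hg⟩ := R.one_mem_rightCoeff
  rw [LinearMap.mem_ker, Module.Dual.eval_apply, ← hg, ← dual_leftSlice, hf', map_zero]

/-- The counit of `P(A, R)`: the functional sending `∑ f(R²) R¹` to `f(1)` for all `f`. For a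
presentation `R = ∑ aᵢ ⊗ bᵢ` of minimal length, `aᵢ` is sent to `bᵢ*(1)`. -/
noncomputable def counit : R.P →ₗ[k] k :=
  (LinearMap.ker R.slice).liftQ (Module.Dual.eval k A 1) R.ker_slice_le ∘ₗ
    (R.slice.quotKerEquivOfSurjective R.slice_surjective).symm.toLinearMap

theorem counit_slice (f : Module.Dual k A) : R.counit (R.slice f) = f 1 := by
  have h : (R.slice.quotKerEquivOfSurjective R.slice_surjective).symm (R.slice f) =
      Submodule.Quotient.mk f := by
    rw [LinearEquiv.symm_apply_eq]
    rfl
  simp [counit, h]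

noncomputable instance : CoalgebraStruct k R.P where
  comul := R.comul
  counit := R.counit

end PentagonSolution

end

/-! ### Hopf algebras -/

/-- An algebra `L` with given linear maps `comul : L → L ⊗ L` and `counit : L → k` is a Hopf
algebra: there is a Hopf algebra structure on the ring `L` whose underlying algebra structure,
comultiplication and counit are the given ones (the antipode is then unique). -/
def IsHopfAlgebra (k L : Type*) [Field k] [Ring L] [i : Algebra k L] [c : CoalgebraStruct k L] :
    Prop :=
  ∃ h : HopfAlgebra k L, h.toAlgebra = i ∧ HEq h.toCoalgebraStruct c

theorem isHopfAlgebra_of_hopfAlgebra (k L : Type*) [Field k] [Ring L] [h : HopfAlgebra k L] :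
    IsHopfAlgebra k L :=
  ⟨h, rfl, HEq.rfl⟩

end Pentagon

namespace Pentagon

/-! The bridge between the two notions is the canonical element. If `L` is a finite-dimensional Hopf
algebra with basis `a s`, and `L` and its dual both map into `A`, the dual basis going to `b s`,
then `R = ∑ a s ⊗ b s` encodes the structure of `L`: `(Δ ⊗ id) R = R¹³ R²³` says that multiplication
of the `b s` is dual to `Δ`, and `(ε ⊗ id) R = 1` does the same for the counit. If moreover `Δ(x) =
R⁻¹ (1 ⊗ x) R`, then `(Δ ⊗ id) R = R¹³ R²³` is exactly the pentagon equation.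

From `R` to Hopf algebra: `φ ↦ ∑ φ(a s) ⊗ b s` embeds `Hom(L, B)` in `B ⊗ A` and turns convolution
into multiplication (`elem_mul`). The coalgebra axioms thus come from associativity and unitality of
`B ⊗ A`, and the antipode from invertibility of `R` (`exists_antipode`). Multiplicativity of `Δ` is
that of conjugation; multiplicativity of `ε` comes from `R¹² R¹³ = R²³ R¹² (R²³)⁻¹`.

From Hopf algebra to `R`: right multiplications and the operators `b ↦ f(b₁) b₂` represent the
Heisenberg double on `L` itself (`rightMul_mul_dualAct`), which gives a solution with `n = dim L`.

Dimensions: `y ↦ (1 ⊗ y) R` makes `A` a Hopf module over `L`, so `A ≅ A^{R,r} ⊗ L`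
(`Presentation.finrank_eq`). The length is `dim L` because the left coefficients of a sum of `m`
elementary tensors lie in a span of `m` vectors. -/

/-- A finite-dimensional coalgebra `L` mapped dually into an algebra `A`: a basis `a` of `L` and a
linearly independent family `b` in `A` such that `a s ↦ b s` identifies the dual algebra of `L`
with a subalgebra of `A`. The functionals `f` are dual to `b`. -/
structure CanonicalElement (k L A ι : Type*) [Field k] [AddCommGroup L] [Module k L]
    [CoalgebraStruct k L] [Ring A] [Algebra k A] [Fintype ι] where
  /-- the basis of `L` -/
  a : Module.Basis ι k L
  /-- the dual family in `A` -/
  b : ι → A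
  /-- functionals dual to `b` -/
  f : ι → Module.Dual k A
  f_self : ∀ s, f s (b s) = 1
  f_ne : ∀ s t, s ≠ t → f s (b t) = 0
  comul_sum : ∑ s, Coalgebra.comul (R := k) (a s) ⊗ₜ[k] b s =
    ∑ s, ∑ t, (a s ⊗ₜ[k] a t) ⊗ₜ[k] (b s * b t)
  counit_sum : ∑ s, Coalgebra.counit (R := k) (a s) • b s = 1

/-! ### Convolution through the canonical element, and the coalgebra axioms. -/

namespace CanonicalElement

section

variable {k L A ι : Type*} [Field k] [AddCommGroup L] [Module k L]
  [CoalgebraStruct k L] [Ring A] [Algebra k A] [Fintype ι] (c : CanonicalElement k L A ι)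

theorem sum_f {M : Type*} [AddCommGroup M] [Module k M] (s : ι) (x : ι → M) :
    ∑ t, c.f s (c.b t) • x t = x s := by
  rw [Finset.sum_eq_single s, c.f_self, one_smul]
  · intro t _ h
    rw [c.f_ne s t h.symm, zero_smul]
  · simp

theorem f_one (s : ι) : c.f s 1 = Coalgebra.counit (R := k) (c.a s) := by
  rw [← c.counit_sum, map_sum]
  simp only [map_smul, smul_eq_mul, mul_comm _ (c.f s _)]
  exact c.sum_f s fun t ↦ Coalgebra.counit (R := k) (c.a t)

/-- The element `∑ φ(a s) ⊗ b s`. -/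
noncomputable def elem {B : Type*} [AddCommGroup B] [Module k B] :
    (L →ₗ[k] B) →ₗ[k] B ⊗[k] A where
  toFun φ := ∑ s, φ (c.a s) ⊗ₜ c.b s
  map_add' φ ψ := by simp [TensorProduct.add_tmul, Finset.sum_add_distrib]
  map_smul' r φ := by simp [TensorProduct.smul_tmul', Finset.smul_sum]

theorem elem_apply {B : Type*} [AddCommGroup B] [Module k B] (φ : L →ₗ[k] B) :
    c.elem φ = ∑ s, φ (c.a s) ⊗ₜ c.b s := rfl

/-- The functional `f s` on the second leg extracts `φ(a s)`, and `φ` is determined by its values on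
a basis. -/
theorem elem_injective {B : Type*} [AddCommGroup B] [Module k B] :
    Function.Injective (c.elem (B := B)) := by
  intro φ ψ h
  refine c.a.ext fun s ↦ ?_
  have h1 : ∀ φ : L →ₗ[k] B,
      TensorProduct.rid k B ((c.f s).lTensor B (c.elem φ)) = φ (c.a s) := by
    intro φ
    simp [elem_apply, c.sum_f s fun t ↦ φ (c.a t)]
  rw [← h1, h, h1]

/-- Apply `φ ⊗ ψ` followed by multiplication to `(Δ ⊗ id) R = R¹³ R²³`: convolution becomes the
product of `B ⊗ A`. No coassociativity is assumed, so the coalgebra axioms can be deduced from this.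
-/
theorem elem_mul {B : Type*} [Ring B] [Algebra k B] (φ ψ : L →ₗ[k] B) :
    c.elem φ * c.elem ψ =
      c.elem (LinearMap.mul' k B ∘ₗ TensorProduct.map φ ψ ∘ₗ Coalgebra.comul) := by
  have h := congrArg ((LinearMap.mul' k B ∘ₗ TensorProduct.map φ ψ).rTensor A) c.comul_sum
  simp only [map_sum, LinearMap.rTensor_tmul] at h
  simp only [elem_apply, Finset.sum_mul_sum]
  simpa using h.symm

theorem elem_counit {B : Type*} [Ring B] [Algebra k B] :
    c.elem (Algebra.linearMap k B ∘ₗ Coalgebra.counit) = 1 := by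
  simp only [elem_apply, LinearMap.comp_apply, Algebra.linearMap_apply, Algebra.algebraMap_eq_smul_one,
    TensorProduct.smul_tmul, ← TensorProduct.tmul_sum, c.counit_sum]
  rfl

end

section Algebra

variable {k L A ι : Type*} [Field k] [Ring L] [Algebra k L]
  [CoalgebraStruct k L] [Ring A] [Algebra k A] [Fintype ι] (c : CanonicalElement k L A ι)

theorem elem_algHom {B B' : Type*} [Ring B] [Algebra k B] [Ring B'] [Algebra k B']
    (g : B →ₐ[k] B') (φ : L →ₗ[k] B) :
    c.elem (g.toLinearMap ∘ₗ φ) = Algebra.TensorProduct.map g (AlgHom.id k A) (c.elem φ) := by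
  simp [elem_apply]

theorem elem_comul : c.elem Coalgebra.comul =
    c.elem (TensorProduct.mk k L L |>.flip 1) * c.elem (TensorProduct.mk k L L 1) := by
  rw [elem_mul]
  congr 1
  conv_lhs => rw [← LinearMap.id_comp (Coalgebra.comul (R := k) (A := L))]
  rw [← LinearMap.comp_assoc]
  congr 1
  ext
  simp

/-- With `i₁, i₂, i₃` the inclusions of the three factors, the two sides are the convolutions `(i₁ *
i₂) * i₃` and `i₁ * (i₂ * i₃)`, since `Δ` is itself the convolution of the two inclusions into `L ⊗
L`. They agree because `(L ⊗ L ⊗ L) ⊗ A` is associative. -/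
theorem coassoc (c : CanonicalElement k L A ι) :
    TensorProduct.assoc k L L L ∘ₗ Coalgebra.comul.rTensor L ∘ₗ Coalgebra.comul =
    Coalgebra.comul.lTensor L ∘ₗ (Coalgebra.comul (R := k) (A := L)) := by
  have h1 : TensorProduct.assoc k L L L ∘ₗ Coalgebra.comul.rTensor L =
      LinearMap.mul' k (L ⊗[k] (L ⊗[k] L)) ∘ₗ
        TensorProduct.map ((leg12 k L).toLinearMap ∘ₗ Coalgebra.comul)
          (TensorProduct.mk k L (L ⊗[k] L) 1 ∘ₗ TensorProduct.mk k L L 1) := by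
    ext x y
    simp only [TensorProduct.AlgebraTensorModule.curry_apply, LinearMap.restrictScalars_self,
      TensorProduct.curry_apply, LinearMap.comp_apply, LinearMap.rTensor_tmul,
      LinearEquiv.coe_coe, TensorProduct.map_tmul, LinearMap.mul'_apply]
    induction Coalgebra.comul (R := k) x with
    | zero => simp
    | add p q hp hq => simp [TensorProduct.add_tmul, add_mul, hp, hq]
    | tmul p q => simp [leg12]
  have h2 : (Coalgebra.comul (R := k) (A := L)).lTensor L =
      LinearMap.mul' k (L ⊗[k] (L ⊗[k] L)) ∘ₗ
        TensorProduct.map ((TensorProduct.mk k L (L ⊗[k] L)).flip 1)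
          ((leg23 k L).toLinearMap ∘ₗ Coalgebra.comul) := by
    ext x y
    simp [leg23]
  apply c.elem_injective
  rw [← LinearMap.comp_assoc, h1, h2, LinearMap.comp_assoc, LinearMap.comp_assoc, ← elem_mul,
    ← elem_mul, elem_algHom, elem_algHom, elem_comul, map_mul, map_mul, ← elem_algHom,
    ← elem_algHom, ← elem_algHom, ← elem_algHom]
  exact mul_assoc (G := (L ⊗[k] (L ⊗[k] L)) ⊗[k] A) _ _ _

theorem rTensor_counit_comp_comul (c : CanonicalElement k L A ι) :
    (Coalgebra.counit (R := k) (A := L)).rTensor L ∘ₗ Coalgebra.comul =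
    TensorProduct.mk k k L 1 := by
  have h1 : (Coalgebra.counit (R := k) (A := L)).rTensor L =
      LinearMap.mul' k (k ⊗[k] L) ∘ₗ
        TensorProduct.map (Algebra.linearMap k (k ⊗[k] L) ∘ₗ Coalgebra.counit)
          (TensorProduct.mk k k L 1) := by
    ext x y
    simp [Algebra.TensorProduct.algebraMap_apply]
  apply c.elem_injective
  rw [h1, LinearMap.comp_assoc, ← elem_mul, elem_counit]
  exact one_mul (M := (k ⊗[k] L) ⊗[k] A) _

theorem lTensor_counit_comp_comul (c : CanonicalElement k L A ι) :
    (Coalgebra.counit (R := k) (A := L)).lTensor L ∘ₗ Coalgebra.comul =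
    (TensorProduct.mk k L k).flip 1 := by
  have h1 : (Coalgebra.counit (R := k) (A := L)).lTensor L =
      LinearMap.mul' k (L ⊗[k] k) ∘ₗ
        TensorProduct.map ((TensorProduct.mk k L k).flip 1)
          (Algebra.linearMap k (L ⊗[k] k) ∘ₗ Coalgebra.counit) := by
    ext x y
    simp [Algebra.algebraMap_eq_smul_one, ← TensorProduct.tmul_smul]
  apply c.elem_injective
  rw [h1, LinearMap.comp_assoc, ← elem_mul, elem_counit]
  exact mul_one (M := (L ⊗[k] k) ⊗[k] A) _

/-- The coalgebra structure. -/
noncomputable abbrev coalgebra : Coalgebra k L :=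
  { (inferInstance : CoalgebraStruct k L) with
    coassoc := c.coassoc
    rTensor_counit_comp_comul := c.rTensor_counit_comp_comul
    lTensor_counit_comp_comul := c.lTensor_counit_comp_comul }

/-- If `∑ a s ⊗ b s` is not a zero divisor then the identity has a left convolution inverse. -/
theorem exists_elem_mul_eq_one
    (h : ∀ x : L ⊗[k] A, x * c.elem LinearMap.id = 0 → x = 0) :
    ∃ S : L →ₗ[k] L, c.elem S * c.elem LinearMap.id = 1 := by
  have := Module.Finite.of_basis c.a
  let m : (L →ₗ[k] L) →ₗ[k] (L →ₗ[k] L) :=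
    { toFun φ := LinearMap.mul' k L ∘ₗ TensorProduct.map φ LinearMap.id ∘ₗ Coalgebra.comul
      map_add' φ ψ := by
        rw [TensorProduct.map_add_left, LinearMap.add_comp, LinearMap.comp_add]
      map_smul' r φ := by
        rw [TensorProduct.map_smul_left, LinearMap.smul_comp, LinearMap.comp_smul]; rfl }
  have hm : ∀ φ, c.elem (m φ) = c.elem φ * c.elem LinearMap.id := fun φ ↦ (c.elem_mul _ _).symm
  -- Right convolution by the identity is an injective endomorphism of the finite-dimensional space
  -- `Hom(L, L)`, so it reaches the convolution unit.
  have hinj : Function.Injective m := by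
    rw [injective_iff_map_eq_zero]
    intro φ hφ
    apply c.elem_injective
    rw [map_zero]
    apply h
    rw [← hm, hφ, map_zero]
  obtain ⟨S, hS⟩ := LinearMap.injective_iff_surjective.mp hinj
    (Algebra.linearMap k L ∘ₗ Coalgebra.counit)
  exact ⟨S, by rw [← hm, hS, elem_counit]⟩

end Algebra

end CanonicalElement

/-! ### From an isomorphism with `P(A, R)` to a presentation. -/

theorem leftSlice_tmul_sum {k A ι : Type*} [Field k] [Ring A] [Algebra k A] [Fintype ι]
    (x y : ι → A) (f : Module.Dual k A) :
    leftSlice (∑ s, x s ⊗ₜ[k] y s) f = ∑ s, f (y s) • x s := by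
  simp [leftSlice]

theorem rightSlice_tmul_sum {k A ι : Type*} [Field k] [Ring A] [Algebra k A] [Fintype ι]
    (x y : ι → A) (f : Module.Dual k A) :
    rightSlice (∑ s, x s ⊗ₜ[k] y s) f = ∑ s, f (x s) • y s := by
  simp [rightSlice]

theorem assoc_conj_tmul {k A : Type*} [Field k] [Ring A] [Algebra k A] (S U : A ⊗[k] A)
    (x y : A) :
    TensorProduct.assoc k A A A ((S * ((1 : A) ⊗ₜ[k] x) * U) ⊗ₜ[k] y) =
      leg12 k A S * ((1 : A) ⊗ₜ[k] (x ⊗ₜ[k] y) * leg12 k A U) := by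
  induction S with
  | zero => simp
  | add p q hp hq => simp only [map_add, add_mul, TensorProduct.add_tmul, hp, hq]
  | tmul c d =>
    induction U with
    | zero => simp
    | add p q hp hq => simp only [map_add, mul_add, TensorProduct.add_tmul, hp, hq]
    | tmul p q => simp [leg12, mul_assoc]

/-- An identification, along `i`, of `L` with the left coefficients of `R`, compatible with the
comultiplications and counits. -/
structure Presentation {k A : Type*} [Field k] [Ring A] [Algebra k A] (R : PentagonSolution k A)
    (L ι : Type*) [Ring L] [Algebra k L] [CoalgebraStruct k L] [Fintype ι]
    extends CanonicalElement k L A ι where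
  /-- the embedding of `L` in `A` -/
  i : L →ₐ[k] A
  i_injective : Function.Injective i
  unit_eq : (R.unit : A ⊗[k] A) = ∑ s, i (a s) ⊗ₜ[k] b s
  comul_eq : ∀ x : L, TensorProduct.map i.toLinearMap i.toLinearMap (Coalgebra.comul (R := k) x) =
    ↑R.unit⁻¹ * ((1 : A) ⊗ₜ[k] i x) * (R.unit : A ⊗[k] A)

section

variable {k A L : Type*} [Field k] [Ring A] [Algebra k A]
  [Ring L] [Algebra k L]

theorem exists_unit_eq_sum [Module.Finite k A] (R : PentagonSolution k A) {ι : Type*} [Fintype ι]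
    (i : L →ₗ[k] A) (hr : leftCoeff (R.unit : A ⊗[k] A) ≤ LinearMap.range i)
    (a : Module.Basis ι k L) : ∃ b : ι → A, (R.unit : A ⊗[k] A) = ∑ s, i (a s) ⊗ₜ[k] b s := by
  have h : ∀ f : Module.Dual k A, ∃ x : L, i x = leftSlice (R.unit : A ⊗[k] A) f :=
    fun f ↦ hr (LinearMap.mem_range_self _ f)
  choose x hx using h
  let β := Module.finBasis k A
  refine ⟨fun j ↦ ∑ s, a.repr (x (β.coord s)) j • β s, ?_⟩
  conv_lhs => rw [leftSlice_sum (R.unit : A ⊗[k] A)]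
  simp only [TensorProduct.tmul_sum]
  rw [Finset.sum_comm]
  refine Finset.sum_congr rfl fun s _ ↦ ?_
  rw [← hx]
  conv_lhs => rw [← a.sum_repr (x (β.coord s))]
  simp only [map_sum, map_smul, TensorProduct.sum_tmul, TensorProduct.smul_tmul]
  rfl

variable [CoalgebraStruct k L]

/-- In `A ⊗ A ⊗ A`, where `Δ` is conjugation by `R`, this is the pentagon equation solved for `R¹³
R²³`. Flatness over a field allows the descent to `L ⊗ L ⊗ A`. -/
theorem PentagonSolution.sum_comul_tmul (R : PentagonSolution k A) {ι : Type*} [Fintype ι]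
    {i : L →ₐ[k] A} (hi : Function.Injective i) {a : ι → L} {b : ι → A}
    (hR : (R.unit : A ⊗[k] A) = ∑ s, i (a s) ⊗ₜ[k] b s)
    (hΔ : ∀ x : L, TensorProduct.map i.toLinearMap i.toLinearMap (Coalgebra.comul (R := k) x) =
      ↑R.unit⁻¹ * ((1 : A) ⊗ₜ[k] i x) * (R.unit : A ⊗[k] A)) :
    ∑ s, Coalgebra.comul (R := k) (a s) ⊗ₜ[k] b s =
      ∑ s, ∑ t, (a s ⊗ₜ[k] a t) ⊗ₜ[k] (b s * b t) := by
  have hi2 : Function.Injective (TensorProduct.map i.toLinearMap i.toLinearMap) :=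
    TensorProduct.map_injective_of_flat_flat _ _ hi hi
  have hi3 : Function.Injective
      ((TensorProduct.map i.toLinearMap i.toLinearMap).rTensor A) :=
    Module.Flat.rTensor_preserves_injective_linearMap _ hi2
  apply hi3
  apply (TensorProduct.assoc k A A A).injective
  simp only [map_sum, LinearMap.rTensor_tmul, hΔ, assoc_conj_tmul]
  rw [← Finset.mul_sum, ← Finset.sum_mul]
  have h23 : ∑ s, (1 : A) ⊗ₜ[k] (i (a s) ⊗ₜ[k] b s) = leg23 k A R.unit := by
    rw [hR, map_sum]; rfl
  rw [h23, ← R.leg13_mul_leg23, hR, map_sum, map_sum, Finset.sum_mul_sum]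
  simp [leg13, leg23]

theorem exists_presentation [Module.Finite k A] (R : PentagonSolution k A) {i : L →ₐ[k] A}
    (hi : Function.Injective i)
    (hr : LinearMap.range i.toLinearMap = leftCoeff (R.unit : A ⊗[k] A))
    (hΔ : ∀ x : L, TensorProduct.map i.toLinearMap i.toLinearMap (Coalgebra.comul (R := k) x) =
      ↑R.unit⁻¹ * ((1 : A) ⊗ₜ[k] i x) * (R.unit : A ⊗[k] A))
    (hε : ∀ (x : L) (f : Module.Dual k A), i x = leftSlice (R.unit : A ⊗[k] A) f →
      Coalgebra.counit (R := k) x = f 1) :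
    Nonempty (Presentation R L (Fin (Module.finrank k L))) := by
  have : Module.Finite k L := Module.Finite.of_injective i.toLinearMap hi
  let a := Module.finBasis k L
  obtain ⟨b, hb⟩ := exists_unit_eq_sum R i.toLinearMap hr.ge a
  have hf : ∀ s, ∃ f : Module.Dual k A, leftSlice (R.unit : A ⊗[k] A) f = i (a s) := fun s ↦
    hr.le (LinearMap.mem_range_self i.toLinearMap (a s))
  choose f hf using hf
  -- Slicing `R` by `f s` gives `i (a s)`, so uniqueness of coordinates in `L` forces `f` to be dual
  -- to `b`.
  have hfb : ∀ s t, f s (b t) = a.repr (a s) t := by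
    intro s t
    have h := hf s
    rw [hb, leftSlice_tmul_sum] at h
    have h2 : i (∑ t, f s (b t) • a t) = i (a s) := by
      rw [map_sum, ← h]
      simp
    have h3 := hi h2
    rw [← h3, a.repr_sum_self]
  refine ⟨{ a := a, b := b, f := f, f_self := ?_, f_ne := ?_, comul_sum := ?_, counit_sum := ?_
            i := i, i_injective := hi, unit_eq := hb, comul_eq := hΔ }⟩
  · intro s
    simp [hfb]
  · intro s t h
    simp [hfb, Finsupp.single_eq_of_ne, h.symm]
  · exact R.sum_comul_tmul hi hb hΔ
  -- Since `1` is the right slice of `R` by some `g`, the counit is `g ∘ i`, and applying `g` to the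
  -- first leg of `R` gives `1`.
  · obtain ⟨g, hg⟩ := R.one_mem_rightCoeff
    have h1 : ∀ s, Coalgebra.counit (R := k) (a s) = g (i (a s)) := by
      intro s
      rw [hε (a s) (f s) (hf s).symm, ← hg, ← dual_leftSlice, hf]
    simp only [h1]
    conv_rhs => rw [← hg, hb]
    rw [rightSlice_tmul_sum]
    rfl

theorem exists_presentation_of_bialgEquiv [Module.Finite k A] (R : PentagonSolution k A)
    (e : L ≃ₐc[k] R.P) : Nonempty (Presentation R L (Fin (Module.finrank k L))) := by
  refine exists_presentation R (i := R.P.val.comp (e : L ≃ₐ[k] R.P).toAlgHom) ?_ ?_ ?_ ?_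
  · exact Subtype.val_injective.comp (EquivLike.injective e)
  · ext x
    constructor
    · rintro ⟨y, rfl⟩
      exact (e y).2
    · intro hx
      obtain ⟨y, hy⟩ := EquivLike.surjective e (⟨x, hx⟩ : R.P)
      exact ⟨y, congrArg Subtype.val hy⟩
  · intro x
    have h := R.incl_comul (e x)
    have h2 : R.comul (e x) = TensorProduct.map (e : L →ₗ[k] R.P) (e : L →ₗ[k] R.P)
        (Coalgebra.comul (R := k) x) := (CoalgHomClass.map_comp_comul_apply e x).symm
    rw [h2] at h
    refine Eq.trans ?_ h
    exact LinearMap.congr_fun (TensorProduct.map_comp R.P.val.toLinearMap R.P.val.toLinearMap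
      (e : L →ₗ[k] R.P) (e : L →ₗ[k] R.P)) (Coalgebra.comul (R := k) x)
  · intro x f hx
    have h1 : e x = R.slice f := Subtype.ext hx
    have h2 : R.counit (e x) = Coalgebra.counit (R := k) x :=
      CoalgHomClass.counit_comp_apply e x
    rw [← h2, h1, R.counit_slice]

end

/-! ### The Hopf algebra structure on the left coefficients. -/

namespace Presentation

variable {k A L ι : Type*} [Field k] [Ring A] [Algebra k A]
  [Ring L] [Algebra k L] [CoalgebraStruct k L] [Fintype ι] {R : PentagonSolution k A}
  (p : Presentation R L ι)

theorem map_elem_id : Algebra.TensorProduct.map p.i (AlgHom.id k A) (p.elem LinearMap.id) =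
    (R.unit : A ⊗[k] A) := by
  simp [CanonicalElement.elem_apply, p.unit_eq]

theorem map_injective {B : Type*} [Ring B] [Algebra k B] :
    Function.Injective (Algebra.TensorProduct.map p.i (AlgHom.id k B)) :=
  Module.Flat.rTensor_preserves_injective_linearMap (M := B) p.i.toLinearMap p.i_injective

theorem map_i_i_injective :
    Function.Injective (Algebra.TensorProduct.map p.i p.i) :=
  TensorProduct.map_injective_of_flat_flat _ _ p.i_injective p.i_injective

theorem map_comul (x : L) : Algebra.TensorProduct.map p.i p.i (Coalgebra.comul (R := k) x) =
    ↑R.unit⁻¹ * ((1 : A) ⊗ₜ[k] p.i x) * (R.unit : A ⊗[k] A) :=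
  p.comul_eq x

theorem comul_one (p : Presentation R L ι) : Coalgebra.comul (R := k) (1 : L) = 1 := by
  apply p.map_i_i_injective
  rw [p.map_comul, map_one, map_one, ← Algebra.TensorProduct.one_def, mul_one, Units.inv_mul]

theorem comul_mul (p : Presentation R L ι) (x y : L) : Coalgebra.comul (R := k) (x * y) =
    Coalgebra.comul (R := k) x * Coalgebra.comul (R := k) y := by
  apply p.map_i_i_injective
  rw [p.map_comul, map_mul p.i, map_mul (Algebra.TensorProduct.map p.i p.i), p.map_comul,
    p.map_comul]
  have h : (1 : A) ⊗ₜ[k] (p.i x * p.i y) = (1 : A) ⊗ₜ[k] p.i x * (1 : A) ⊗ₜ[k] p.i y := by simp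
  rw [h]
  simp only [mul_assoc]
  rw [Units.mul_inv_cancel_left]

theorem counit_one [Nontrivial A] (p : Presentation R L ι) :
    Coalgebra.counit (R := k) (1 : L) = 1 := by
  have : Nontrivial L := p.i.toRingHom.domain_nontrivial
  have h := congrArg (TensorProduct.lid k L)
    (LinearMap.congr_fun p.rTensor_counit_comp_comul (1 : L))
  rw [LinearMap.comp_apply, p.comul_one, Algebra.TensorProduct.one_def] at h
  simp only [LinearMap.rTensor_tmul, TensorProduct.lid_tmul, TensorProduct.mk_apply] at h
  exact smul_left_injective k (one_ne_zero (α := L)) h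

/-- The algebra map form of `R¹² R¹³ = R²³ R¹² (R²³)⁻¹`, with first leg in `L`. -/
theorem sum_mul_tmul : ∑ s, ∑ t, (p.a s * p.a t) ⊗ₜ[k] (p.b s ⊗ₜ[k] p.b t) =
    ((1 : L) ⊗ₜ[k] (R.unit : A ⊗[k] A)) * (∑ s, p.a s ⊗ₜ[k] (p.b s ⊗ₜ[k] (1 : A))) *
      ((1 : L) ⊗ₜ[k] (↑R.unit⁻¹ : A ⊗[k] A)) := by
  apply p.map_injective
  have h12 : ∑ s, p.i (p.a s) ⊗ₜ[k] (p.b s ⊗ₜ[k] (1 : A)) = leg12 k A R.unit := by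
    rw [p.unit_eq, map_sum]; simp [leg12]
  have h13 : ∑ s, p.i (p.a s) ⊗ₜ[k] ((1 : A) ⊗ₜ[k] p.b s) = leg13 k A R.unit := by
    rw [p.unit_eq, map_sum]; simp [leg13]
  have h := R.leg12_mul_leg13
  rw [← h12, ← h13, Finset.sum_mul_sum] at h
  simpa [leg23] using h

/-- Applying `ε` to the first leg of `R¹² R¹³ = R²³ R¹² (R²³)⁻¹` collapses the right side to `1`,
because `(ε ⊗ id) R = 1`. Hence `∑ ε(a s * a t) b s ⊗ b t = 1 ⊗ 1`, and pairing with `f s ⊗ f t`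
reads off the coefficients. -/
theorem counit_mul (p : Presentation R L ι) (x y : L) : Coalgebra.counit (R := k) (x * y) =
    Coalgebra.counit (R := k) x * Coalgebra.counit (R := k) y := by
  have hE : ∀ (u v : A ⊗[k] A) (z : L ⊗[k] (A ⊗[k] A)),
      TensorProduct.lid k (A ⊗[k] A) ((Coalgebra.counit (R := k) (A := L)).rTensor (A ⊗[k] A)
        ((1 ⊗ₜ[k] u) * z * (1 ⊗ₜ[k] v))) =
      u * TensorProduct.lid k (A ⊗[k] A)
        ((Coalgebra.counit (R := k) (A := L)).rTensor (A ⊗[k] A) z) * v := by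
    intro u v z
    induction z with
    | zero => simp
    | add z w hz hw => simp only [mul_add, add_mul, map_add, hz, hw]
    | tmul z w => simp
  have h := congrArg (fun z ↦ TensorProduct.lid k (A ⊗[k] A)
    ((Coalgebra.counit (R := k) (A := L)).rTensor (A ⊗[k] A) z)) p.sum_mul_tmul
  simp only [hE] at h
  simp only [map_sum, LinearMap.rTensor_tmul, TensorProduct.lid_tmul] at h
  simp only [TensorProduct.smul_tmul', ← TensorProduct.sum_tmul, p.counit_sum] at h
  rw [← Algebra.TensorProduct.one_def, mul_one, Units.mul_inv] at h
  have key : ∀ s t, Coalgebra.counit (R := k) (p.a s * p.a t) =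
      Coalgebra.counit (R := k) (p.a s) * Coalgebra.counit (R := k) (p.a t) := by
    intro s t
    have h2 := congrArg (pair (p.f s) (p.f t)) h
    rw [Algebra.TensorProduct.one_def] at h2
    simp only [map_sum, pair, LinearMap.comp_apply,
      TensorProduct.map_tmul, LinearMap.mul'_apply, map_smul, smul_eq_mul, p.f_one] at h2
    rw [← h2]
    have h3 : ∀ u v, Coalgebra.counit (R := k) (p.a u * p.a v) * p.f s (p.b u) * p.f t (p.b v) =
        p.f s (p.b u) • (p.f t (p.b v) • Coalgebra.counit (R := k) (p.a u * p.a v)) := by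
      intro u v
      simp only [smul_eq_mul]
      ring
    simp only [h3, ← Finset.smul_sum]
    rw [p.sum_f s fun u ↦ _, p.sum_f t fun v ↦ _]
  have h4 : (LinearMap.mul k L).compr₂ (Coalgebra.counit (R := k) (A := L)) =
      (LinearMap.mul k k).compl₁₂ Coalgebra.counit Coalgebra.counit :=
    p.a.ext fun s ↦ p.a.ext fun t ↦ key s t
  exact LinearMap.congr_fun (LinearMap.congr_fun h4 x) y

/-- The bialgebra structure. -/
noncomputable abbrev bialgebra [Nontrivial A] (p : Presentation R L ι) : Bialgebra k L :=
  letI := p.coalgebra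
  Bialgebra.mk' k L p.counit_one (p.counit_mul _ _) p.comul_one (p.comul_mul _ _)

/-- `L ⊗ A` embeds in `A ⊗ A`, where the canonical element becomes the unit `R`. So it is not a zero
divisor, and its left inverse is mapped to `R⁻¹` and is two-sided. -/
theorem exists_antipode [Module.Finite k A] (p : Presentation R L ι) : ∃ S : L →ₗ[k] L,
    p.elem S * p.elem LinearMap.id = 1 ∧ p.elem LinearMap.id * p.elem S = 1 := by
  obtain ⟨S, hS⟩ := p.exists_elem_mul_eq_one (by
    intro x hx
    apply p.map_injective
    have h := congrArg (Algebra.TensorProduct.map p.i (AlgHom.id k A)) hx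
    rw [map_mul, map_elem_id, map_zero, Units.mul_left_eq_zero] at h
    rw [h, map_zero])
  refine ⟨S, hS, ?_⟩
  apply p.map_injective
  have h := congrArg (Algebra.TensorProduct.map p.i (AlgHom.id k A)) hS
  rw [map_mul, map_elem_id, map_one] at h
  rw [map_mul, map_elem_id, map_one, ← Units.inv_eq_of_mul_eq_one_left h, Units.mul_inv]

theorem exists_hopfAlgebra [Module.Finite k A] [Nontrivial A] (p : Presentation R L ι) :
    ∃ h : HopfAlgebra k L, h.toAlgebra = ‹Algebra k L› ∧
      HEq h.toCoalgebraStruct ‹CoalgebraStruct k L› := by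
  obtain ⟨S, h1, h2⟩ := p.exists_antipode
  rw [p.elem_mul, ← p.elem_counit] at h1 h2
  exact ⟨{ p.bialgebra with
    antipode := S
    mul_antipode_rTensor_comul := p.elem_injective h1
    mul_antipode_lTensor_comul := p.elem_injective h2 }, rfl, HEq.rfl⟩

end Presentation

/-! ### Bijectivity of the antipode in finite dimension. -/

section Antipode

open HopfAlgebra Coalgebra WithConv

variable {k H : Type*} [Field k] [Ring H] [HopfAlgebra k H]

/-- Left convolution by `S` is injective, with `id * (S * φ) = φ`. It preserves the maps valued in
the image of `S`, because `S(x) S(y) = S(y x)`. In finite dimension it is then onto on this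
subspace, which contains the convolution unit. The preimage of the unit can only be the identity, so
the identity is valued in the image of `S`. -/
theorem antipode_surjective [Module.Finite k H] :
    Function.Surjective (antipode k (A := H)) := by
  set S := antipode k (A := H) with hS
  let N : Submodule k (H →ₗ[k] H) :=
    { carrier := {φ | ∀ x, φ x ∈ LinearMap.range S}
      zero_mem' := fun _ ↦ zero_mem _
      add_mem' := fun h1 h2 x ↦ add_mem (h1 x) (h2 x)
      smul_mem' := fun c _ h x ↦ Submodule.smul_mem _ c (h x) }
  let m : (H →ₗ[k] H) →ₗ[k] (H →ₗ[k] H) :=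
    { toFun φ := (toConv S * toConv φ).ofConv
      map_add' φ ψ := by rw [toConv_add, mul_add, ofConv_add]
      map_smul' r φ := by rw [toConv_smul, mul_smul_comm, ofConv_smul]; rfl }
  have hinv : ∀ φ, toConv φ = toConv LinearMap.id * toConv (m φ) := by
    intro φ
    change toConv φ = toConv LinearMap.id * (toConv S * toConv φ)
    rw [← mul_assoc, LinearMap.id_mul_antipode, one_mul]
  have hm : ∀ φ ∈ N, m φ ∈ N := by
    intro φ hφ x
    change (toConv S * toConv φ) x ∈ _
    rw [(ℛ k x).convMul_apply]
    refine Submodule.sum_mem _ fun j _ ↦ ?_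
    obtain ⟨y, hy⟩ := hφ ((ℛ k x).right j)
    refine ⟨y * (ℛ k x).left j, ?_⟩
    rw [hS, antipode_mul_antidistrib, ← hS, hy]
  have hinj : Function.Injective (m.restrict hm) := by
    intro φ ψ h
    have h1 : m φ = m ψ := congrArg Subtype.val h
    have h2 := hinv φ
    rw [h1, ← hinv] at h2
    exact Subtype.ext (toConv_injective h2)
  have h1 : (1 : WithConv (H →ₗ[k] H)).ofConv ∈ N := by
    intro x
    refine ⟨algebraMap k H (counit x), ?_⟩
    rw [Algebra.algebraMap_eq_smul_one, map_smul, hS, antipode_one,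
      ← Algebra.algebraMap_eq_smul_one]
    rfl
  obtain ⟨φ, hφ⟩ := (LinearMap.injective_iff_surjective (K := k) (V := N)
    (f := m.restrict hm)).mp hinj ⟨_, h1⟩
  have h2 : m φ = (1 : WithConv (H →ₗ[k] H)).ofConv := congrArg Subtype.val hφ
  have h3 := hinv φ
  rw [h2, toConv_ofConv, mul_one] at h3
  intro x
  have h4 := φ.2 x
  rw [toConv_injective h3] at h4
  exact h4

/-- Both sides are convolution inverses of `Δ` in `Hom(H, H ⊗ H)`: with `Δ = i₁ * i₂`, the right
side is `(i₂ ∘ S) * (i₁ ∘ S)`. -/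
theorem comul_comp_antipode : comul ∘ₗ antipode k (A := H) =
    TensorProduct.map (antipode k) (antipode k) ∘ₗ TensorProduct.comm k H H ∘ₗ comul := by
  let i₁ : H →ₐ[k] H ⊗[k] H := Algebra.TensorProduct.includeLeft
  let i₂ : H →ₐ[k] H ⊗[k] H := Algebra.TensorProduct.includeRight
  have hcancel : ∀ i : H →ₐ[k] H ⊗[k] H,
      toConv (i.toLinearMap ∘ₗ antipode k) * toConv i.toLinearMap = 1 := by
    intro i
    have h := LinearMap.algHom_comp_convMul_distrib i (toConv (antipode k (A := H)))
      (toConv LinearMap.id)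
    rw [LinearMap.antipode_mul_id] at h
    refine toConv_injective.eq_iff.mp (congrArg toConv (h.symm.trans ?_)) |> ofConv_injective
    ext x
    simp
  have hδ : toConv (comul (R := k) (A := H)) = toConv i₁.toLinearMap * toConv i₂.toLinearMap := by
    apply ofConv_injective
    ext x
    change comul x = (toConv i₁.toLinearMap * toConv i₂.toLinearMap) x
    rw [(ℛ k x).convMul_apply]
    conv_lhs => rw [← (ℛ k x).eq]
    simp [i₁, i₂]
  have hG : toConv (TensorProduct.map (antipode k) (antipode k) ∘ₗ
      TensorProduct.comm k H H ∘ₗ comul (R := k) (A := H)) =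
      toConv (i₂.toLinearMap ∘ₗ antipode k) * toConv (i₁.toLinearMap ∘ₗ antipode k) := by
    apply ofConv_injective
    ext x
    change _ = (toConv (i₂.toLinearMap ∘ₗ antipode k) * toConv (i₁.toLinearMap ∘ₗ antipode k)) x
    rw [(ℛ k x).convMul_apply]
    simp only [LinearMap.comp_apply]
    conv_lhs => rw [← (ℛ k x).eq]
    simp [i₁, i₂]
  refine toConv_injective (left_inv_eq_right_inv ?_ LinearMap.comul_right_inv).symm
  rw [hG, hδ, mul_assoc, ← mul_assoc (toConv (i₁.toLinearMap ∘ₗ _)), hcancel, one_mul, hcancel]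

/-- The inverse of the antipode of a finite-dimensional Hopf algebra. -/
theorem exists_skew_antipode [Module.Finite k H] : ∃ T : H →ₗ[k] H,
    LinearMap.mul' k H ∘ₗ TensorProduct.comm k H H ∘ₗ T.rTensor H ∘ₗ comul =
      Algebra.linearMap k H ∘ₗ counit ∧
    LinearMap.mul' k H ∘ₗ TensorProduct.comm k H H ∘ₗ T.lTensor H ∘ₗ comul =
      Algebra.linearMap k H ∘ₗ counit ∧
    comul ∘ₗ T = TensorProduct.map T T ∘ₗ TensorProduct.comm k H H ∘ₗ comul := by
  have hs := antipode_surjective (k := k) (H := H)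
  have hi := LinearMap.injective_iff_surjective.mpr hs
  let e := LinearEquiv.ofBijective (antipode k (A := H)) ⟨hi, hs⟩
  have he : ∀ x, antipode k (e.symm x) = x := fun x ↦ e.apply_symm_apply x
  have hε : ∀ c : k, antipode k (algebraMap k H c) = algebraMap k H c := by
    intro c
    rw [Algebra.algebraMap_eq_smul_one, map_smul, antipode_one]
  refine ⟨e.symm.toLinearMap, ?_, ?_, ?_⟩
  -- Applying `S` turns `x₂ T(x₁)` into `x₁ S(x₂)`, so the claim becomes an antipode axiom; the next
  -- case is symmetric.
  · ext x
    apply hi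
    simp only [LinearMap.comp_apply, Algebra.linearMap_apply, hε]
    rw [← mul_antipode_lTensor_comul_apply]
    induction comul (R := k) x with
    | zero => simp
    | add u v hu hv => simp only [map_add, hu, hv]
    | tmul u v => simp [antipode_mul_antidistrib, he]
  · ext x
    apply hi
    simp only [LinearMap.comp_apply, Algebra.linearMap_apply, hε]
    rw [← mul_antipode_rTensor_comul_apply]
    induction comul (R := k) x with
    | zero => simp
    | add u v hu hv => simp only [map_add, hu, hv]
    | tmul u v => simp [antipode_mul_antidistrib, he]
  · ext x
    obtain ⟨y, rfl⟩ := hs x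
    have h := LinearMap.congr_fun (comul_comp_antipode (k := k) (H := H)) y
    simp only [LinearMap.comp_apply, LinearEquiv.coe_coe] at h ⊢
    rw [h, show e.symm (antipode k y) = y from e.symm_apply_apply y]
    induction comul (R := k) y with
    | zero => simp
    | add u v hu hv => simp only [map_add, ← hu, ← hv]
    | tmul u v =>
      simp [show ∀ y, e.symm (antipode k y) = y from e.symm_apply_apply]

end Antipode

/-! ### The Hopf module structure on `A` and the dimension formula. -/

namespace Presentation

open Coalgebra

section

variable {k A L ι : Type*} [Field k] [Ring A] [Algebra k A]
  [Ring L] [Algebra k L] [CoalgebraStruct k L] [Fintype ι] {R : PentagonSolution k A}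
  (p : Presentation R L ι)

/-- The coaction `y ↦ (1 ⊗ y) R` of `L` on `A`. -/
noncomputable def coact : A →ₗ[k] L ⊗[k] A where
  toFun y := ∑ s, p.a s ⊗ₜ (y * p.b s)
  map_add' y z := by simp [add_mul, TensorProduct.tmul_add, Finset.sum_add_distrib]
  map_smul' r y := by simp [Finset.smul_sum]

theorem coact_apply (y : A) : p.coact y = ∑ s, p.a s ⊗ₜ (y * p.b s) := rfl

theorem coact_eq (y : A) : p.coact y = ((1 : L) ⊗ₜ[k] y) * p.elem LinearMap.id := by
  simp [coact_apply, CanonicalElement.elem_apply, Finset.mul_sum]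

theorem map_coact (y : A) : Algebra.TensorProduct.map p.i (AlgHom.id k A) (p.coact y) =
    ((1 : A) ⊗ₜ[k] y) * (R.unit : A ⊗[k] A) := by
  simp [coact_eq, p.map_elem_id]

theorem mem_rightCoinvariants (y : A) :
    y ∈ rightCoinvariants (R.unit : A ⊗[k] A) ↔ p.coact y = 1 ⊗ₜ y := by
  rw [← p.map_injective.eq_iff, map_coact, Algebra.TensorProduct.map_tmul, map_one,
    AlgHom.id_apply]
  rfl

theorem coact_i (x : L) : p.coact (p.i x) =
    p.elem LinearMap.id * p.i.toLinearMap.lTensor L (comul (R := k) x) := by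
  apply p.map_injective
  have h : Algebra.TensorProduct.map p.i (AlgHom.id k A)
      (p.i.toLinearMap.lTensor L (comul (R := k) x)) =
      Algebra.TensorProduct.map p.i p.i (comul (R := k) x) := by
    induction comul (R := k) x with
    | zero => simp
    | add u v hu hv => simp only [map_add, hu, hv]
    | tmul u v => simp
  rw [map_mul, map_coact, map_elem_id, h, map_comul, mul_assoc, Units.mul_inv_cancel_left]

/-- Compatibility of the coaction with right multiplication by `L`, the Hopf module axiom. It rests
on `(1 ⊗ x) R = R Δ(x)`. -/
theorem coact_mul_i (y : A) (x : L) : p.coact (y * p.i x) =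
    p.coact y * p.i.toLinearMap.lTensor L (comul (R := k) x) := by
  have h : (1 : L) ⊗ₜ[k] (y * p.i x) = (1 : L) ⊗ₜ[k] y * (1 : L) ⊗ₜ[k] p.i x := by simp
  rw [coact_eq, h, mul_assoc, ← coact_eq, coact_i, ← mul_assoc, ← coact_eq]

end

section

variable {k A L ι : Type*} [Field k] [Ring A] [Algebra k A]
  [Ring L] [HopfAlgebra k L] [Fintype ι] {R : PentagonSolution k A}
  (p : Presentation R L ι) {T : L →ₗ[k] L}
  (hT₁ : LinearMap.mul' k L ∘ₗ TensorProduct.comm k L L ∘ₗ T.rTensor L ∘ₗ comul =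
      Algebra.linearMap k L ∘ₗ counit)
  (hT₂ : LinearMap.mul' k L ∘ₗ TensorProduct.comm k L L ∘ₗ T.lTensor L ∘ₗ comul =
      Algebra.linearMap k L ∘ₗ counit)
  (hT₃ : comul ∘ₗ T = TensorProduct.map T T ∘ₗ TensorProduct.comm k L L ∘ₗ comul)

/-- The element `∑ b s * T(a s)`. -/
noncomputable def proj (T : L →ₗ[k] L) : A := ∑ s, p.b s * p.i (T (p.a s))

theorem sum_b_mul_i_counit : ∑ s, p.b s * p.i (algebraMap k L (counit (p.a s))) = 1 := by
  simp only [Algebra.algebraMap_eq_smul_one, map_smul, map_one, mul_smul_comm, mul_one,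
    p.counit_sum]

include hT₂ in
-- By `(Δ ⊗ id) R = R¹³ R²³`, the sum `∑ b s b t T(a t) a s` contracts to `∑ b u T(x₂) x₁` with `x =
-- a u`, that is, to `∑ ε(a u) b u = 1`. This yields surjectivity in `finrank_eq`.
theorem sum_b_mul_proj_mul : ∑ s, p.b s * p.proj T * p.i (p.a s) = 1 := by
  let m : (L ⊗[k] L) ⊗[k] A →ₗ[k] A := TensorProduct.lift
    ((LinearMap.mul k A).flip ∘ₗ p.i.toLinearMap ∘ₗ LinearMap.mul' k L ∘ₗ
      TensorProduct.comm k L L ∘ₗ T.lTensor L)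
  have h := congrArg m p.comul_sum
  simp only [map_sum, m, TensorProduct.lift.tmul, LinearMap.comp_apply, LinearMap.flip_apply,
    LinearMap.mul_apply'] at h
  have h2 : ∀ x : L, LinearMap.mul' k L ((TensorProduct.comm k L L) (T.lTensor L (comul x))) =
      algebraMap k L (counit x) := fun x ↦ LinearMap.congr_fun hT₂ x
  simp only [LinearEquiv.coe_coe, h2, AlgHom.toLinearMap_apply, p.sum_b_mul_i_counit,
    LinearMap.lTensor_tmul, TensorProduct.comm_tmul, LinearMap.mul'_apply, map_mul] at h
  rw [h]
  refine Finset.sum_congr rfl fun s _ ↦ ?_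
  simp only [proj, Finset.mul_sum, Finset.sum_mul, mul_assoc]

include hT₁ in
theorem mul_i_mul_proj {c : A} (hc : c ∈ rightCoinvariants (R.unit : A ⊗[k] A)) (x : L) :
    c * p.i x * p.proj T = counit (R := k) x • c := by
  rw [p.mem_rightCoinvariants] at hc
  let m : L ⊗[k] A →ₗ[k] A := TensorProduct.lift
    ((LinearMap.mul k A).flip ∘ₗ p.i.toLinearMap ∘ₗ T)
  -- The usual Hopf module projection onto coinvariants, `y ↦ y₀ T(y₋₁)`, is here right
  -- multiplication by the single element `proj T`.
  have hm : ∀ y, m (p.coact y) = y * p.proj T := by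
    intro y
    simp [m, coact_apply, proj, Finset.mul_sum, mul_assoc]
  rw [← hm, coact_mul_i, hc]
  have h2 : LinearMap.mul' k L (TensorProduct.comm k L L (T.rTensor L (comul x))) =
      algebraMap k L (counit x) := LinearMap.congr_fun hT₁ x
  have h3 : ∀ z : L ⊗[k] L, m (1 ⊗ₜ[k] c * p.i.toLinearMap.lTensor L z) =
      c * p.i (LinearMap.mul' k L (TensorProduct.comm k L L (T.rTensor L z))) := by
    intro z
    induction z with
    | zero => simp
    | add u v hu hv => simp only [map_add, mul_add, hu, hv]
    | tmul u v => simp [m, mul_assoc]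
  rw [h3, h2]
  simp [Algebra.algebraMap_eq_smul_one]

include hT₁ in
theorem sum_coact_b_mul : ∑ t, p.coact (p.b t) * (T (p.a t) ⊗ₜ[k] (1 : A)) = 1 := by
  have h := congrArg ((LinearMap.mul' k L ∘ₗ TensorProduct.comm k L L ∘ₗ T.rTensor L).rTensor A)
    p.comul_sum
  have h2 : ∀ x : L, LinearMap.mul' k L (TensorProduct.comm k L L (T.rTensor L (comul x))) =
      algebraMap k L (counit x) := fun x ↦ LinearMap.congr_fun hT₁ x
  simp only [map_sum, LinearMap.rTensor_tmul, LinearMap.comp_apply, LinearEquiv.coe_coe, h2] at h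
  simp only [Algebra.algebraMap_eq_smul_one, TensorProduct.smul_tmul, ← TensorProduct.tmul_sum,
    p.counit_sum] at h
  rw [Algebra.TensorProduct.one_def, h]
  simp [coact_apply, Finset.sum_mul]

include hT₁ hT₃ in
-- Since `T` reverses `Δ`, the coaction of `proj T` is `∑ coact(b s * b t) (T(a t) ⊗ T(a s))`. The
-- inner sum over `t` is `1` by `sum_coact_b_mul`, which leaves `1 ⊗ proj T`.
theorem proj_mem : p.proj T ∈ rightCoinvariants (R.unit : A ⊗[k] A) := by
  rw [p.mem_rightCoinvariants]
  let Ψ : L ⊗[k] L →ₗ[k] L ⊗[k] A := p.i.toLinearMap.lTensor L ∘ₗ TensorProduct.map T T ∘ₗ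
    TensorProduct.comm k L L
  let m : (L ⊗[k] L) ⊗[k] A →ₗ[k] L ⊗[k] A := TensorProduct.lift
    ((LinearMap.mul k (L ⊗[k] A)).flip.compl₁₂ Ψ p.coact)
  have h := congrArg m p.comul_sum
  simp only [map_sum, m, TensorProduct.lift.tmul, LinearMap.compl₁₂_apply, LinearMap.flip_apply,
    LinearMap.mul_apply'] at h
  have h1 : ∀ x, Ψ (comul x) = p.i.toLinearMap.lTensor L (comul (T x)) := fun x ↦
    congrArg (p.i.toLinearMap.lTensor L) (LinearMap.congr_fun hT₃ x).symm
  simp only [h1, ← coact_mul_i, ← map_sum] at h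
  have h2 : ∀ y z, p.coact (y * z) = ((1 : L) ⊗ₜ[k] y) * p.coact z := by
    intro y z
    simp [coact_apply, Finset.mul_sum, mul_assoc]
  have h3 : ∀ s t, Ψ (p.a s ⊗ₜ p.a t) =
      (T (p.a t) ⊗ₜ[k] (1 : A)) * ((1 : L) ⊗ₜ[k] p.i (T (p.a s))) := by
    intro s t
    simp [Ψ]
  simp only [h2 (p.b _) (p.b _), h3] at h
  rw [proj, h, TensorProduct.tmul_sum]
  refine Finset.sum_congr rfl fun s _ ↦ ?_
  have h4 : ∀ t, 1 ⊗ₜ[k] p.b s * p.coact (p.b t) *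
      ((T (p.a t) ⊗ₜ[k] (1 : A)) * ((1 : L) ⊗ₜ[k] p.i (T (p.a s)))) =
      1 ⊗ₜ[k] p.b s * (p.coact (p.b t) * (T (p.a t) ⊗ₜ[k] (1 : A))) *
        ((1 : L) ⊗ₜ[k] p.i (T (p.a s))) := by
    intro t
    simp only [mul_assoc]
  simp only [h4, ← Finset.sum_mul, ← Finset.mul_sum, p.sum_coact_b_mul hT₁]
  simp

theorem mul_mem_rightCoinvariants {y : A} (z : A)
    (hy : y ∈ rightCoinvariants (R.unit : A ⊗[k] A)) :
    z * y ∈ rightCoinvariants (R.unit : A ⊗[k] A) := by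
  change (1 : A) ⊗ₜ[k] (z * y) * (R.unit : A ⊗[k] A) = 1 ⊗ₜ (z * y)
  have h : (1 : A) ⊗ₜ[k] (z * y) = (1 : A) ⊗ₜ[k] z * (1 : A) ⊗ₜ[k] y := by simp
  rw [h, mul_assoc, show (1 : A) ⊗ₜ[k] y * (R.unit : A ⊗[k] A) = 1 ⊗ₜ y from hy]

/-- The fundamental theorem of Hopf modules for `A`. -/
theorem finrank_eq [Module.Finite k A] (p : Presentation R L ι) :
    Module.finrank k A =
      Module.finrank k (rightCoinvariants (R.unit : A ⊗[k] A)) * Module.finrank k L := by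
  have : Module.Finite k L := Module.Finite.of_basis p.a
  obtain ⟨T, hT₁, hT₂, hT₃⟩ := exists_skew_antipode (k := k) (H := L)
  let C := rightCoinvariants (R.unit : A ⊗[k] A)
  let Φ : C ⊗[k] L →ₗ[k] A := TensorProduct.lift
    ((LinearMap.mul k A).compl₁₂ C.subtype p.i.toLinearMap)
  have hΦ : ∀ (c : C) (x : L), Φ (c ⊗ₜ x) = c * p.i x := fun c x ↦ rfl
  -- `y ↦ ∑ y b s (proj T) ⊗ a s`. It undoes `Φ` because `c x ↦ ∑ c x₂ (proj T) ⊗ x₁ = c ⊗ x` for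
  -- coinvariant `c`.
  let Ψ : A →ₗ[k] A ⊗[k] L := TensorProduct.comm k L A ∘ₗ
    (LinearMap.mulRight k (p.proj T)).lTensor L ∘ₗ p.coact
  have hinj : Function.Injective Φ := by
    have h1 : Ψ ∘ₗ Φ = C.subtype.rTensor L := by
      ext c x
      have h2 : p.coact (c * p.i x) =
          (LinearMap.mulLeft k (c : A) ∘ₗ p.i.toLinearMap).lTensor L (comul x) := by
        rw [coact_mul_i, (p.mem_rightCoinvariants _).mp c.2]
        induction comul (R := k) x with
        | zero => simp
        | add u v hu hv => simp only [map_add, mul_add, hu, hv]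
        | tmul u v => simp
      have h3 : LinearMap.mulRight k (p.proj T) ∘ₗ LinearMap.mulLeft k (c : A) ∘ₗ
          p.i.toLinearMap = (LinearMap.toSpanSingleton k A (c : A)) ∘ₗ counit := by
        ext y
        simp [p.mul_i_mul_proj hT₁ c.2]
      change (TensorProduct.comm k L A) ((LinearMap.mulRight k (p.proj T)).lTensor L
        (p.coact (c * p.i x))) = (c : A) ⊗ₜ x
      rw [h2, ← LinearMap.lTensor_comp_apply, h3, LinearMap.lTensor_comp_apply,
        lTensor_counit_comul]
      simp
    have h2 : Function.Injective (C.subtype.rTensor L) :=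
      Module.Flat.rTensor_preserves_injective_linearMap _ C.injective_subtype
    rw [← h1, LinearMap.coe_comp] at h2
    exact Function.Injective.of_comp h2
  have hsurj : Function.Surjective Φ := by
    intro y
    -- The coinvariants form a left ideal containing `proj T`, so these coefficients are
    -- coinvariant.
    refine ⟨∑ s, (⟨y * p.b s * p.proj T,
      mul_mem_rightCoinvariants _ (p.proj_mem hT₁ hT₃)⟩ : C) ⊗ₜ p.a s, ?_⟩
    rw [map_sum]
    simp only [hΦ]
    have h := congrArg (y * ·) (p.sum_b_mul_proj_mul hT₂)
    simp only [Finset.mul_sum, mul_one] at h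
    conv_rhs => rw [← h]
    refine Finset.sum_congr rfl fun s _ ↦ ?_
    simp only [mul_assoc]
  rw [← (LinearEquiv.ofBijective Φ ⟨hinj, hsurj⟩).finrank_eq, Module.finrank_tensorProduct]

end

/-! ### The length of `R`. -/

theorem leftSlice_f {k A L ι : Type*} [Field k] [Ring A] [Algebra k A]
    [Ring L] [Algebra k L] [CoalgebraStruct k L] [Fintype ι] {R : PentagonSolution k A}
    (p : Presentation R L ι) (s : ι) :
    leftSlice (R.unit : A ⊗[k] A) (p.f s) = p.i (p.a s) := by
  rw [p.unit_eq, leftSlice_tmul_sum]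
  exact p.sum_f s fun t ↦ p.i (p.a t)

theorem finrank_eq_tensorLength {k A L ι : Type*} [Field k] [Ring A] [Algebra k A]
    [Ring L] [Algebra k L] [CoalgebraStruct k L] [Fintype ι] {R : PentagonSolution k A}
    (p : Presentation R L ι) : Module.finrank k L = tensorLength (R.unit : A ⊗[k] A) := by
  have hmem : Module.finrank k L ∈
      {m : ℕ | ∃ x y : Fin m → A, (R.unit : A ⊗[k] A) = ∑ j, x j ⊗ₜ[k] y j} := by
    rw [Module.finrank_eq_card_basis p.a]
    let e := Fintype.equivFin ι
    exact ⟨fun s ↦ p.i (p.a (e.symm s)), fun s ↦ p.b (e.symm s), by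
      rw [p.unit_eq]
      exact (e.symm.sum_comp fun s ↦ p.i (p.a s) ⊗ₜ[k] p.b s).symm⟩
  refine le_antisymm (le_csInf ⟨_, hmem⟩ ?_) (Nat.sInf_le hmem)
  rintro m ⟨x, y, h⟩
  have h1 : LinearMap.range p.i.toLinearMap ≤ Submodule.span k (Set.range x) := by
    rw [LinearMap.range_eq_map, ← p.a.span_eq, Submodule.map_span, Submodule.span_le]
    rintro _ ⟨_, ⟨s, rfl⟩, rfl⟩
    change p.i (p.a s) ∈ _
    rw [← p.leftSlice_f, h, leftSlice_tmul_sum]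
    exact Submodule.sum_mem _ fun j _ ↦
      Submodule.smul_mem _ _ (Submodule.subset_span ⟨j, rfl⟩)
  have : Module.Finite k (Submodule.span k (Set.range x)) :=
    Module.Finite.span_of_finite k (Set.finite_range x)
  calc Module.finrank k L = Module.finrank k (LinearMap.range p.i.toLinearMap) :=
        (LinearMap.finrank_range_of_inj p.i_injective).symm
    _ ≤ Module.finrank k (Submodule.span k (Set.range x)) := Submodule.finrank_mono h1
    _ ≤ Fintype.card (Fin m) := finrank_range_le_card x
    _ = m := Fintype.card_fin m

end Presentation

/-! ### A presentation identifies `L` with `P(A, R)`. -/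

section

variable {k A L ι : Type*} [Field k] [Ring A] [Algebra k A]
  [Ring L] [Algebra k L] [CoalgebraStruct k L] [Fintype ι] {R : PentagonSolution k A}
  (p : Presentation R L ι)

theorem Presentation.range_i : LinearMap.range p.i.toLinearMap =
    leftCoeff (R.unit : A ⊗[k] A) := by
  apply le_antisymm
  · rw [LinearMap.range_eq_map, ← p.a.span_eq, Submodule.map_span, Submodule.span_le]
    rintro _ ⟨_, ⟨s, rfl⟩, rfl⟩
    exact ⟨p.f s, p.leftSlice_f s⟩
  · rintro _ ⟨f, rfl⟩
    rw [p.unit_eq, leftSlice_tmul_sum]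
    exact Submodule.sum_mem _ fun s _ ↦
      Submodule.smul_mem _ _ (LinearMap.mem_range_self p.i.toLinearMap (p.a s))

theorem Presentation.nonempty_bialgEquiv [Module.Finite k A] (p : Presentation R L ι) :
    Nonempty (L ≃ₐc[k] R.P) := by
  have hmem : ∀ x, p.i x ∈ R.P := fun x ↦ p.range_i.le (LinearMap.mem_range_self p.i.toLinearMap x)
  let φ : L →ₐ[k] R.P := p.i.codRestrict R.P hmem
  have hφ : Function.Bijective φ := by
    refine ⟨fun x y h ↦ p.i_injective (congrArg Subtype.val h), ?_⟩
    rintro ⟨x, hx⟩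
    obtain ⟨y, hy⟩ := p.range_i.ge hx
    exact ⟨y, Subtype.ext hy⟩
  have hε : R.counit ∘ₗ φ.toLinearMap = Coalgebra.counit := by
    refine p.a.ext fun s ↦ ?_
    have h : φ (p.a s) = R.slice (p.f s) := Subtype.ext (p.leftSlice_f s).symm
    change R.counit (φ (p.a s)) = _
    rw [h, R.counit_slice, p.f_one]
  have hΔ : TensorProduct.map φ.toLinearMap φ.toLinearMap ∘ₗ Coalgebra.comul =
      R.comul ∘ₗ φ.toLinearMap := by
    ext x
    apply R.incl_injective
    refine Eq.trans ?_ ((p.comul_eq x).trans (R.incl_comul (φ x)).symm)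
    exact (LinearMap.congr_fun (TensorProduct.map_comp R.P.val.toLinearMap R.P.val.toLinearMap
      φ.toLinearMap φ.toLinearMap) (Coalgebra.comul (R := k) x)).symm
  exact ⟨{ AlgEquiv.ofBijective φ hφ with
    map_smul' := map_smul φ
    counit_comp := hε
    map_comp_comul := hΔ }⟩

end

/-! ### From the Heisenberg double to pentagon solutions. -/

theorem sum_pair_coord_smul {k L ι : Type*} [Field k] [AddCommGroup L] [Module k L] [Fintype ι]
    (a : Module.Basis ι k L) (z : L ⊗[k] L) :
    ∑ s, ∑ t, (LinearMap.mul' k k (TensorProduct.map (a.coord s) (a.coord t) z)) •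
      (a s ⊗ₜ[k] a t) = z := by
  induction z with
  | zero => simp
  | add u v hu hv => simp only [map_add, add_smul, Finset.sum_add_distrib, hu, hv]
  | tmul u v =>
    conv_rhs => rw [← a.sum_repr u, ← a.sum_repr v]
    rw [TensorProduct.sum_tmul]
    simp only [TensorProduct.tmul_sum, TensorProduct.smul_tmul_smul]
    rfl

/-- An endomorphism acting on one leg of the canonical element can be moved to the other leg as its
transpose. -/
theorem sum_tmul_coord_comp {k L ι M : Type*} [Field k] [AddCommGroup L] [Module k L] [Fintype ι]
    [AddCommGroup M] [Module k M] (a : Module.Basis ι k L) (j : Module.Dual k L →ₗ[k] M)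
    (T : L →ₗ[k] L) :
    ∑ s, a s ⊗ₜ[k] j (a.coord s ∘ₗ T) = ∑ s, T (a s) ⊗ₜ[k] j (a.coord s) := by
  have h1 : ∀ s, a.coord s ∘ₗ T = ∑ t, a.repr (T (a t)) s • a.coord t := by
    intro s
    refine a.ext fun u ↦ ?_
    rw [LinearMap.sum_apply, Finset.sum_eq_single u]
    · simp
    · intro t _ h
      simp [Finsupp.single_eq_of_ne, h]
    · simp
  have h2 : ∀ s, T (a s) = ∑ t, a.repr (T (a s)) t • a t := fun s ↦ (a.sum_repr _).symm
  simp only [h1, map_sum, map_smul, TensorProduct.tmul_sum]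
  rw [Finset.sum_comm]
  refine Finset.sum_congr rfl fun s _ ↦ ?_
  conv_rhs => rw [h2 s]
  simp only [TensorProduct.sum_tmul, TensorProduct.smul_tmul]

section

open Coalgebra HopfAlgebra

variable {k A L : Type*} [Field k] [Ring A] [Algebra k A] [Ring L] [HopfAlgebra k L]

/-- A Hopf algebra and its dual acting compatibly, that is, a representation of the Heisenberg
double, give a pentagon solution. -/
theorem exists_presentation_of_heisenberg [Module.Finite k L] {i : L →ₐ[k] A}
    (hi : Function.Injective i) {j : Module.Dual k L →ₗ[k] A} (hj : Function.Injective j)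
    (hmul : ∀ f g, j f * j g = j (LinearMap.mul' k k ∘ₗ TensorProduct.map f g ∘ₗ comul))
    (hone : j counit = 1)
    (hcomm : ∀ (f : Module.Dual k L) (x : L), i x * j f = ∑ q ∈ (ℛ k x).index,
      j (f ∘ₗ LinearMap.mulRight k ((ℛ k x).left q)) * i ((ℛ k x).right q)) :
    ∃ R : PentagonSolution k A, Nonempty (Presentation R L (Fin (Module.finrank k L))) := by
  let a := Module.finBasis k L
  obtain ⟨g, hg⟩ := j.exists_leftInverse_of_injective (LinearMap.ker_eq_bot.mpr hj)
  have hgj : ∀ f, g (j f) = f := LinearMap.congr_fun hg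
  let c : CanonicalElement k L A (Fin (Module.finrank k L)) :=
    { a := a
      b := fun s ↦ j (a.coord s)
      f := fun s ↦ Module.Dual.eval k L (a s) ∘ₗ g
      f_self := fun s ↦ by simp [hgj]
      f_ne := fun s t h ↦ by simp [hgj, Finsupp.single_eq_of_ne, h.symm]
      comul_sum := by
        have h1 : ∀ φ : Module.Dual k L, j φ = ∑ u, φ (a u) • j (a.coord u) := by
          intro φ
          conv_lhs => rw [← a.sum_dual_apply_smul_coord φ]
          simp only [map_sum, map_smul]
        have h2 : ∀ s t, j (a.coord s) * j (a.coord t) = ∑ u, LinearMap.mul' k k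
            (TensorProduct.map (a.coord s) (a.coord t) (comul (a u))) • j (a.coord u) := by
          intro s t
          rw [hmul, h1]
          rfl
        simp only [h2, TensorProduct.tmul_sum]
        have h3 : ∀ u, comul (R := k) (a u) ⊗ₜ[k] j (a.coord u) =
            ∑ s, ∑ t, (a s ⊗ₜ[k] a t) ⊗ₜ[k] (LinearMap.mul' k k
              (TensorProduct.map (a.coord s) (a.coord t) (comul (a u))) • j (a.coord u)) := by
          intro u
          conv_lhs => rw [← sum_pair_coord_smul a (comul (a u))]
          simp only [TensorProduct.sum_tmul, TensorProduct.smul_tmul]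
        simp only [h3]
        rw [Finset.sum_comm]
        exact Finset.sum_congr rfl fun s _ ↦ Finset.sum_comm
      counit_sum := by
        rw [← hone]
        conv_rhs => rw [← a.sum_dual_apply_smul_coord (counit : L →ₗ[k] k)]
        simp only [map_sum, map_smul] }
  have hS1 : c.elem (antipode k) * c.elem LinearMap.id = 1 := by
    rw [c.elem_mul, ← c.elem_counit, ← mul_antipode_rTensor_comul]
    rfl
  have hS2 : c.elem LinearMap.id * c.elem (antipode k) = 1 := by
    rw [c.elem_mul, ← c.elem_counit, ← mul_antipode_lTensor_comul]
    rfl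
  let μ := Algebra.TensorProduct.map i (AlgHom.id k A)
  let U : (A ⊗[k] A)ˣ := ⟨μ (c.elem LinearMap.id), μ (c.elem (antipode k)),
    by rw [← map_mul, hS2, map_one], by rw [← map_mul, hS1, map_one]⟩
  have hU : (U : A ⊗[k] A) = ∑ s, i (c.a s) ⊗ₜ[k] c.b s := by
    simp [U, μ, c.elem_apply]
  -- The Heisenberg relation `hcomm` is `(1 ⊗ x) R = R Δ(x)` read in coordinates; it makes `Δ`
  -- conjugation by `R`.
  have hcomm2 : ∀ x : L, (1 : L) ⊗ₜ[k] i x * c.elem LinearMap.id =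
      c.elem LinearMap.id * i.toLinearMap.lTensor L (comul (R := k) x) := by
    intro x
    conv_rhs => rw [← (ℛ k x).eq]
    simp only [map_sum, LinearMap.lTensor_tmul, Finset.mul_sum, c.elem_apply,
      Algebra.TensorProduct.tmul_mul_tmul, one_mul, LinearMap.id_apply, Finset.sum_mul]
    have h : ∀ s, i x * c.b s = ∑ q ∈ (ℛ k x).index,
      j (a.coord s ∘ₗ LinearMap.mulRight k ((ℛ k x).left q)) * i ((ℛ k x).right q) :=
      fun s ↦ hcomm _ _
    simp only [h, TensorProduct.tmul_sum]
    rw [Finset.sum_comm]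
    refine Finset.sum_congr rfl fun q _ ↦ ?_
    have h3 := congrArg (· * ((1 : L) ⊗ₜ[k] i ((ℛ k x).right q)))
      (sum_tmul_coord_comp a j (LinearMap.mulRight k ((ℛ k x).left q)))
    simpa [Finset.sum_mul] using h3
  have hΔ : ∀ x : L, TensorProduct.map i.toLinearMap i.toLinearMap (comul (R := k) x) =
      ↑U⁻¹ * ((1 : A) ⊗ₜ[k] i x) * (U : A ⊗[k] A) := by
    intro x
    have h := congrArg μ (hcomm2 x)
    rw [map_mul, map_mul] at h
    have h2 : μ (i.toLinearMap.lTensor L (comul (R := k) x)) =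
        TensorProduct.map i.toLinearMap i.toLinearMap (comul (R := k) x) := by
      induction comul (R := k) x with
      | zero => simp
      | add u v hu hv => simp only [map_add, hu, hv]
      | tmul u v => simp [μ]
    rw [h2] at h
    rw [mul_assoc, Units.eq_inv_mul_iff_mul_eq]
    refine h.symm.trans ?_
    simp [μ, U]
  have hpent : leg12 k A U * leg13 k A U * leg23 k A U = leg23 k A U * leg12 k A U := by
    have h := congrArg ((TensorProduct.assoc k A A A).toLinearMap ∘ₗ
      (TensorProduct.map i.toLinearMap i.toLinearMap).rTensor A) c.comul_sum
    simp only [map_sum, LinearMap.comp_apply, LinearMap.rTensor_tmul, hΔ, LinearEquiv.coe_coe,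
      assoc_conj_tmul] at h
    rw [← Finset.mul_sum, ← Finset.sum_mul] at h
    have h23 : ∑ s, (1 : A) ⊗ₜ[k] (i (c.a s) ⊗ₜ[k] c.b s) = leg23 k A U := by
      rw [hU, map_sum]; rfl
    have h1323 : leg13 k A U * leg23 k A U = leg12 k A ↑U⁻¹ * (leg23 k A U * leg12 k A U) := by
      rw [← h23, h, hU, map_sum, Finset.sum_mul_sum]
      simp [leg13]
    rw [mul_assoc, h1323, ← mul_assoc, ← map_mul, Units.mul_inv, map_one, one_mul]
  exact ⟨⟨U, hpent⟩, ⟨{ c with i := i, i_injective := hi, unit_eq := hU, comul_eq := hΔ }⟩⟩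

end

/-! ### The Heisenberg representation on `L`. -/

section

open Coalgebra HopfAlgebra MulOpposite

variable (k L : Type*) [Field k] [Ring L] [HopfAlgebra k L]

/-- Right multiplication, as an algebra map to `(End L)ᵐᵒᵖ`. -/
noncomputable def rightMul : L →ₐ[k] (Module.End k L)ᵐᵒᵖ :=
  AlgHom.ofLinearMap
    ((opLinearEquiv k).toLinearMap ∘ₗ (LinearMap.mul k L).flip)
    (by apply unop_injective; ext; simp)
    (fun x y ↦ by apply unop_injective; ext; simp [mul_assoc])

theorem unop_rightMul (x y : L) : (rightMul k L x).unop y = y * x := rfl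

theorem rightMul_injective : Function.Injective (rightMul k L) := by
  intro x y h
  have h2 := LinearMap.congr_fun (congrArg unop h) (1 : L)
  simpa [unop_rightMul] using h2

/-- The map sending `f` to the operator `b ↦ f(b₁) b₂`, an element of `(End L)ᵐᵒᵖ`. -/
noncomputable def dualAct : Module.Dual k L →ₗ[k] (Module.End k L)ᵐᵒᵖ where
  toFun f := op ((TensorProduct.lid k L).toLinearMap ∘ₗ f.rTensor L ∘ₗ comul)
  map_add' f g := by apply unop_injective; ext; simp [LinearMap.rTensor_add]
  map_smul' r f := by apply unop_injective; ext; simp [LinearMap.rTensor_smul]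

theorem unop_dualAct (f : Module.Dual k L) (b : L) :
    (dualAct k L f).unop b = TensorProduct.lid k L (f.rTensor L (comul b)) := rfl

theorem counit_dualAct (f : Module.Dual k L) (b : L) :
    counit (R := k) ((dualAct k L f).unop b) = f b := by
  have h : ∀ z : L ⊗[k] L, counit (R := k) (TensorProduct.lid k L (f.rTensor L z)) =
      TensorProduct.lift ((LinearMap.mul k k).compl₁₂ f LinearMap.id)
        ((counit (R := k)).lTensor L z) := by
    intro z
    induction z with
    | zero => simp
    | add u v hu hv => simp only [map_add, hu, hv]
    | tmul u v => simp
  rw [unop_dualAct, h, lTensor_counit_comul]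
  simp

theorem dualAct_injective : Function.Injective (dualAct k L) := by
  intro f g h
  ext b
  rw [← counit_dualAct, h, counit_dualAct]

theorem dualAct_counit : dualAct k L counit = 1 := by
  apply unop_injective
  ext b
  rw [unop_dualAct, rTensor_counit_comul]
  simp

theorem dualAct_mul (f g : Module.Dual k L) : dualAct k L f * dualAct k L g =
    dualAct k L (LinearMap.mul' k k ∘ₗ TensorProduct.map f g ∘ₗ comul) := by
  apply unop_injective
  ext b
  let E : L ⊗[k] (L ⊗[k] L) →ₗ[k] L := (TensorProduct.lid k L).toLinearMap ∘ₗ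
    TensorProduct.map f ((TensorProduct.lid k L).toLinearMap ∘ₗ g.rTensor L)
  have h1 : ∀ z : L ⊗[k] L, (dualAct k L g).unop (TensorProduct.lid k L (f.rTensor L z)) =
      E (comul.lTensor L z) := by
    intro z
    induction z with
    | zero => simp
    | add u v hu hv => simp only [map_add, hu, hv]
    | tmul u v => simp [E, unop_dualAct]
  have h2 : ∀ z : L ⊗[k] L, TensorProduct.lid k L
      ((LinearMap.mul' k k ∘ₗ TensorProduct.map f g ∘ₗ comul).rTensor L z) =
      E (TensorProduct.assoc k L L L (comul.rTensor L z)) := by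
    intro z
    induction z with
    | zero => simp
    | add u v hu hv => simp only [map_add, hu, hv]
    | tmul u v =>
      simp only [LinearMap.rTensor_tmul, LinearMap.comp_apply]
      induction comul (R := k) u with
      | zero => simp
      | add p q hp hq => simp only [map_add, TensorProduct.add_tmul, hp, hq]
      | tmul p q => simp [E, mul_smul, smul_comm (f p)]
  rw [unop_mul, Module.End.mul_apply, unop_dualAct k L f, h1, unop_dualAct, h2, coassoc_apply]

/-- Products in the opposite algebra apply the left factor first, so both sides send `b` to `f(b₁
x₁) b₂ x₂`, by multiplicativity of `Δ`. -/
theorem rightMul_mul_dualAct (f : Module.Dual k L) (x : L) :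
    rightMul k L x * dualAct k L f = ∑ q ∈ (ℛ k x).index,
      dualAct k L (f ∘ₗ LinearMap.mulRight k ((ℛ k x).left q)) *
        rightMul k L ((ℛ k x).right q) := by
  apply unop_injective
  ext b
  rw [unop_mul, Module.End.mul_apply, unop_rightMul, unop_dualAct, Bialgebra.comul_mul,
    Finset.unop_sum, LinearMap.sum_apply]
  conv_lhs => rw [← (ℛ k x).eq]
  rw [Finset.mul_sum, map_sum, map_sum]
  refine Finset.sum_congr rfl fun q _ ↦ ?_
  rw [unop_mul, Module.End.mul_apply, unop_rightMul, unop_dualAct]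
  induction comul (R := k) b with
  | zero => simp
  | add u v hu hv => simp only [map_add, add_mul, hu, hv]
  | tmul u v => simp

theorem exists_presentation_matrix [Module.Finite k L] :
    ∃ R : PentagonSolution k (Matrix (Fin (Module.finrank k L)) (Fin (Module.finrank k L)) k),
      Nonempty (Presentation R L (Fin (Module.finrank k L))) := by
  -- Transposition identifies the opposite of the matrix algebra with the matrix algebra itself.
  let e : (Module.End k L)ᵐᵒᵖ ≃ₐ[k]
      Matrix (Fin (Module.finrank k L)) (Fin (Module.finrank k L)) k :=
    (AlgEquiv.op (algEquivMatrix (Module.finBasis k L))).trans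
      (Matrix.transposeAlgEquiv (Fin (Module.finrank k L)) k k).symm
  refine exists_presentation_of_heisenberg (i := e.toAlgHom.comp (rightMul k L))
    (e.injective.comp (rightMul_injective k L)) (j := e.toLinearMap ∘ₗ dualAct k L)
    (e.injective.comp (dualAct_injective k L)) ?_ ?_ ?_
  · intro f g
    simp only [LinearMap.comp_apply, AlgEquiv.toLinearMap_apply, ← map_mul, dualAct_mul]
  · simp [dualAct_counit]
  · intro f x
    have h := congrArg e (rightMul_mul_dualAct k L f x)
    rw [map_mul, map_sum] at h
    simp only [map_mul] at h
    exact h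

end

end Pentagon

/-! ### The structure theorem. -/

theorem mainTheorem2 {k L : Type*} [Field k] [Ring L] [Algebra k L] [CoalgebraStruct k L] :
    ((Pentagon.IsHopfAlgebra k L ∧ Module.Finite k L) ↔
      ∃ n : ℕ, 0 < n ∧ ∃ R : Pentagon.PentagonSolution k (Matrix (Fin n) (Fin n) k),
        Nonempty (L ≃ₐc[k] R.P)) ∧
    ∀ n : ℕ, 0 < n → ∀ R : Pentagon.PentagonSolution k (Matrix (Fin n) (Fin n) k),
      Nonempty (L ≃ₐc[k] R.P) →
        (Module.finrank k L : ℚ) =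
            (n : ℚ) ^ 2 / (Module.finrank k (Pentagon.rightCoinvariants R.unit.val) : ℚ) ∧
          Module.finrank k L = Pentagon.tensorLength R.unit.val := by
  refine ⟨⟨?_, ?_⟩, ?_⟩
  · rintro ⟨⟨h, rfl, hc⟩, hfin⟩
    obtain rfl := eq_of_heq hc
    have : Nontrivial L := Bialgebra.nontrivial k
    obtain ⟨R, ⟨p⟩⟩ := Pentagon.exists_presentation_matrix k L
    exact ⟨_, Module.finrank_pos, R, p.nonempty_bialgEquiv⟩
  · rintro ⟨n, hn, R, ⟨e⟩⟩
    have : NeZero n := ⟨hn.ne'⟩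
    obtain ⟨p⟩ := Pentagon.exists_presentation_of_bialgEquiv R e
    exact ⟨p.exists_hopfAlgebra, Module.Finite.of_basis p.a⟩
  · rintro n hn R ⟨e⟩
    have : NeZero n := ⟨hn.ne'⟩
    obtain ⟨p⟩ := Pentagon.exists_presentation_of_bialgEquiv R e
    refine ⟨?_, p.finrank_eq_tensorLength⟩
    -- The Hopf structure just constructed extends the given algebra and coalgebra data, so the Hopf
    -- module theorem applies to the same presentation `p` and gives `n² = dim C · dim L`, with `C`
    -- the coinvariants.
    obtain ⟨h, rfl, hc⟩ := p.exists_hopfAlgebra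
    obtain rfl := eq_of_heq hc
    have hd := p.finrank_eq
    rw [Module.finrank_matrix, Fintype.card_fin, Module.finrank_self, mul_one] at hd
    have h0 : Module.finrank k (Pentagon.rightCoinvariants R.unit.val) ≠ 0 := by
      intro h0
      rw [h0, zero_mul] at hd
      exact (Nat.mul_pos hn hn).ne' hd
    rw [eq_div_iff (Nat.cast_ne_zero.mpr h0)]
    have hq := congrArg (Nat.cast (R := ℚ)) hd
    push_cast at hq
    linarith
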